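/- **Definitions.** Let $d\in[1,+\infty]$. For $\rho\in[0,1)$ put $\mathbb A_\rho:=\{z\in\mathbb C:\rho<|z|<1\}$, and let $\omega(\rho):=-\pi/\log \rho$ for $\rho\in(0,1)$, $\omega(0):=0$. Let $\mathbb S:=\{z\in\mathbb C:0<\operatorname{Re}z<1\}$. Let $r:[0,+\infty)\to[0,1)$. The family $(D_t)_{t\ge0}$, $D_t:=\mathbb A_{r(t)}$, is a *canonical domain system of order $d$* if the function $t\mapsto\omega(r(t))$ is non-increasing, locally absolutely continuous on $[0,+\infty)$, and its derivative belongs to $L^d_{\rm loc}([0,+\infty))$. It is *non-degenerate* if $r(t)>0$ for all $t\ge0$. A family $(\varphi_{s,t})_{0\le s\le t<+\infty}$ of holomorphic maps $\varphi_{s,t}:D_s\to D_t$ is an *$L^d$-evolution family over $(D_t)$* if 1. $\varphi_{s,s}=\mathrm{id}_{D_s}$ for all $s\ge0$; 2. $\varphi_{s,t}=\varphi_{u,t}\circ\varphi_{s,u}$ whenever $0\le s\le u\le t$; 3. for every closed interval $[S,T]\subset[0,+\infty)$ and every $z\in D_S$ there is a non-negative function $k\in L^d([S,T],\mathbb R)$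 such that $|\varphi_{s,u}(z)-\varphi_{s,t}(z)|\le\int_u^t k(\xi)\,d\xi$ whenever $S\le s\le u\le t\le T$. A family $(\Psi_{s,t})_{0\le s\le t<+\infty}$ of holomorphic maps $\Psi_{s,t}:\mathbb S\to\mathbb S$ is an *$L^d$-evolution family in $\mathbb S$* if $\Psi_{s,s}=\mathrm{id}_{\mathbb S}$ for all $s\ge0$, $\Psi_{s,t}=\Psi_{u,t}\circ\Psi_{s,u}$ whenever $0\le s\le u\le t$, and for every $T>0$ and every $z\in\mathbb S$ there is a non-negative function $k\in L^d([0,T],\mathbb R)$ such that $|\Psi_{s,t}(z)-\Psi_{s,u}(z)|\le\int_u^t k(\xi)\,d\xi$ whenever $0\le s\le u\le t\le T$. **Theorem.** Let $d\in[1,+\infty]$ and let $(D_t)=(\mathbb A_{r(t)})$ be a non-degenerate canonical domain system of order $d$. Then for every $L^d$-evolution family $(\varphi_{s,t})$ over $(D_t)$ there exists a unique $L^d$-evolution family $(\Psi_{s,t})$ in the strip $\mathbb S$ such that $$W_t\circ\Psi_{s,t}=\varphi_{s,t}\circ W_s\quad\text{on }\mathbb S\text{ for all }0\le s\le t<+\infty,$$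 where $W_\tau(\zeta):=\exp(\zeta\log r(\tau))$ for all $\tau\ge0$ and $\zeta\in\mathbb S$. -/

import Mathlib

open Set MeasureTheory
open scoped ENNReal

noncomputable section

namespace LoewnerAnnuli

/-- `ACd d X f`: the function `f` is of class `AC^d` on `X ⊆ ℝ`, i.e. it is locally absolutely
continuous on `X` (absolutely continuous on every compact interval contained in `X`) and its
derivative, which exists almost everywhere, belongs to `L^d` on every such compact interval. -/
def ACd (d : ℝ≥0∞) (X : Set ℝ) (f : ℝ → ℝ) : Prop :=
  ∀ a b : ℝ, a ≤ b → Icc a b ⊆ X →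
    AbsolutelyContinuousOnInterval f a b ∧ MemLp (deriv f) d (volume.restrict (Icc a b))

/-- The annulus `{z : r < |z| < 1}`. -/
def annulus (r : ℝ) : Set ℂ := {z | r < ‖z‖ ∧ ‖z‖ < 1}

/-- The strip `{z : 0 < Re z < 1}`. -/
def strip : Set ℂ := {z | 0 < z.re ∧ z.re < 1}

/-- `ω(r) = -π / log r` for `0 < r < 1`, and `ω(0) = 0`. -/
def omega (r : ℝ) : ℝ := if r = 0 then 0 else -Real.pi / Real.log r

/-- The annuli `D_t = annulus (r t)`, `t ≥ 0`, form a (doubly connected) canonical domain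
system of order `d`. -/
structure IsCanonicalSystem (d : ℝ≥0∞) (r : ℝ → ℝ) : Prop where
  mem_Ico : ∀ t, 0 ≤ t → r t ∈ Ico (0 : ℝ) 1
  ac : ACd d (Ici 0) (fun t => omega (r t))
  antitone : AntitoneOn (fun t => omega (r t)) (Ici 0)

/-- The system of annuli `annulus (r t)` is non-degenerate: `r` does not vanish on `[0, ∞)`. -/
def IsNondegenerate (r : ℝ → ℝ) : Prop := ∀ t, 0 ≤ t → r t ≠ 0

/-- `φ s t`, `0 ≤ s ≤ t`, is an evolution family of order `d` in the (fixed) domain `D`.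
Only the values of `φ s t` on `D` for `0 ≤ s ≤ t` matter. -/
structure IsEvolutionFamilyIn (d : ℝ≥0∞) (D : Set ℂ) (φ : ℝ → ℝ → ℂ → ℂ) : Prop where
  holo : ∀ s t, 0 ≤ s → s ≤ t → DifferentiableOn ℂ (φ s t) D
  mapsTo : ∀ s t, 0 ≤ s → s ≤ t → MapsTo (φ s t) D D
  ef1 : ∀ s, 0 ≤ s → EqOn (φ s s) id D
  ef2 : ∀ s u t, 0 ≤ s → s ≤ u → u ≤ t → EqOn (φ s t) (φ u t ∘ φ s u) D
  ef3 : ∀ T, 0 < T → ∀ z ∈ D, ∃ k : ℝ → ℝ,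
    (∀ ξ ∈ Icc 0 T, 0 ≤ k ξ) ∧ MemLp k d (volume.restrict (Icc 0 T)) ∧
      ∀ s u t, 0 ≤ s → s ≤ u → u ≤ t → t ≤ T →
        ‖φ s t z - φ s u z‖ ≤ ∫ ξ in u..t, k ξ

/-- `φ s t : D_s → D_t`, `0 ≤ s ≤ t`, is an evolution family of order `d` over the system of
annuli `D_t = annulus (r t)`. Only the values of `φ s t` on `D_s` for `0 ≤ s ≤ t` matter. -/
structure IsEvolutionFamilyOver (d : ℝ≥0∞) (r : ℝ → ℝ) (φ : ℝ → ℝ → ℂ → ℂ) : Prop where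
  holo : ∀ s t, 0 ≤ s → s ≤ t → DifferentiableOn ℂ (φ s t) (annulus (r s))
  mapsTo : ∀ s t, 0 ≤ s → s ≤ t → MapsTo (φ s t) (annulus (r s)) (annulus (r t))
  ef1 : ∀ s, 0 ≤ s → EqOn (φ s s) id (annulus (r s))
  ef2 : ∀ s u t, 0 ≤ s → s ≤ u → u ≤ t → EqOn (φ s t) (φ u t ∘ φ s u) (annulus (r s))
  ef3 : ∀ S T, 0 ≤ S → S ≤ T → ∀ z ∈ annulus (r S), ∃ k : ℝ → ℝ,
    (∀ ξ ∈ Icc S T, 0 ≤ k ξ) ∧ MemLp k d (volume.restrict (Icc S T)) ∧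
      ∀ s u t, S ≤ s → s ≤ u → u ≤ t → t ≤ T →
        ‖φ s u z - φ s t z‖ ≤ ∫ ξ in u..t, k ξ

/-- `W_τ(ζ) = exp (ζ log r(τ))`. -/
def stripMap (r : ℝ → ℝ) (τ : ℝ) (ζ : ℂ) : ℂ := Complex.exp (ζ * (Real.log (r τ) : ℂ))

/-- `Ψ` lifts `φ`: `W_t ∘ Ψ_{s,t} = φ_{s,t} ∘ W_s` on the strip whenever `0 ≤ s ≤ t`. -/
def IsStripLift (r : ℝ → ℝ) (φ Ψ : ℝ → ℝ → ℂ → ℂ) : Prop :=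
  ∀ s t, 0 ≤ s → s ≤ t → EqOn (stripMap r t ∘ Ψ s t) (φ s t ∘ stripMap r s) strip

end LoewnerAnnuli

end

noncomputable section

namespace LoewnerAnnuli

open ComplexConjugate Metric Filter Topology

/-! `W_t` is `exp` after scaling by `log r(t)`, and `φ_{s,t} ∘ W_s` has no zeros, so it has a
logarithm jointly continuous on the simply connected set strip × ℝ, after a constant extension to `t
< s`. Normalised at `t = s` and divided by `log r(t)`, this gives `Ψ_{s,t}` (`exists_lift`). The
integral condition forces continuity in `t`, so uniqueness of lifts through `exp` yields both the
composition law and the uniqueness of the family.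

The hard point is one `L^d` bound valid for all starting times. A fixed point of the strip lies over
the moving point `W_s(z)`, whereas the hypothesis on `φ` controls a fixed point of the annuli
uniformly in `s`. The controlled points of the strip are therefore the moving anchors `x log r(0) /
log r(u)` (`exists_anchor_bound`). A holomorphic self-map that nearly fixes two anchors is near the
identity on compact sets, at a linear rate (`exists_two_point_bound`), so `Ψ_{u,t}` moves every
point of a compact set by at most a multiple of `∫_u^t k` for short intervals
(`exists_displacement_bound`). Hyperbolic contraction keeps the orbits over `[0,T]` in a compact set
(`exists_orbit_bound`). The composition law then turns increments in `t` into such displacements,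
and the short-time bounds add up. -/

/-! ### Schwarz–Pick and two-point rigidity in the upper half-plane. -/

/-- The upper half-plane as a set of complex numbers. -/
def upperHalf : Set ℂ := {z | 0 < z.im}

/-- The Green quotient `(z - w) / (z - conj w)` of the upper half-plane. -/
def pseudo (z w : ℂ) : ℂ := (z - w) / (z - conj w)

theorem sub_conj_ne_zero {z w : ℂ} (hz : z ∈ upperHalf) (hw : w ∈ upperHalf) :
    z - conj w ≠ 0 := by
  intro h
  have := congrArg Complex.im h
  simp only [Complex.sub_im, Complex.conj_im, Complex.zero_im] at this
  have h1 : 0 < z.im := hz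
  have h2 : 0 < w.im := hw
  linarith

theorem norm_sub_conj_sq (z w : ℂ) :
    ‖z - conj w‖ ^ 2 = ‖z - w‖ ^ 2 + 4 * z.im * w.im := by
  simp only [Complex.sq_norm, Complex.normSq_apply, Complex.sub_re, Complex.sub_im,
    Complex.conj_re, Complex.conj_im]
  ring

theorem norm_pseudo_lt_one {z w : ℂ} (hz : z ∈ upperHalf) (hw : w ∈ upperHalf) :
    ‖pseudo z w‖ < 1 := by
  have h := norm_pos_iff.2 (sub_conj_ne_zero hz hw)
  rw [pseudo, norm_div, div_lt_one h]
  have h1 : 0 < z.im := hz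
  have h2 : 0 < w.im := hw
  have := norm_sub_conj_sq z w
  have : 0 < z.im * w.im := by positivity
  exact lt_of_pow_lt_pow_left₀ 2 h.le (by linarith)

theorem differentiableOn_pseudo {F : ℂ → ℂ} {s : Set ℂ} (hF : DifferentiableOn ℂ F s)
    (hm : MapsTo F s upperHalf) {w : ℂ} (hw : w ∈ upperHalf) :
    DifferentiableOn ℂ (fun z => pseudo (F z) w) s :=
  (hF.sub_const w).div (hF.sub_const _) fun _ hz => sub_conj_ne_zero (hm hz) hw

/-- The Cayley-type transform inverse to `pseudo · w`. -/
def pseudoInv (w y : ℂ) : ℂ := (w - y * conj w) / (1 - y)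

theorem one_sub_ne_zero_of_norm_lt {y : ℂ} (hy : ‖y‖ < 1) : 1 - y ≠ 0 := by
  intro h
  rw [← sub_eq_zero.1 h] at hy
  simp at hy

theorem pseudoInv_mem {w y : ℂ} (hw : w ∈ upperHalf) (hy : ‖y‖ < 1) :
    pseudoInv w y ∈ upperHalf := by
  have h1 : 0 < w.im := hw
  have hne := one_sub_ne_zero_of_norm_lt hy
  have hN : 0 < Complex.normSq (1 - y) := Complex.normSq_pos.2 hne
  have hy2 : Complex.normSq y < 1 := by
    rw [← Complex.sq_norm]; nlinarith [norm_nonneg y]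
  have : (pseudoInv w y).im = w.im * (1 - Complex.normSq y) / Complex.normSq (1 - y) := by
    rw [pseudoInv, Complex.div_im]
    field_simp
    simp [Complex.normSq_apply]
    ring
  change 0 < (pseudoInv w y).im
  rw [this]
  have : 0 < 1 - Complex.normSq y := by linarith
  positivity

theorem pseudoInv_pseudo {z w : ℂ} (hz : z ∈ upperHalf) (hw : w ∈ upperHalf) :
    pseudoInv w (pseudo z w) = z := by
  have h := sub_conj_ne_zero hz hw
  have h' := sub_conj_ne_zero hw hw
  have h2 := one_sub_ne_zero_of_norm_lt (norm_pseudo_lt_one hz hw)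
  rw [pseudoInv, div_eq_iff h2, pseudo]
  field_simp
  ring

/-- **Schwarz-Pick** in the upper half-plane, in factored form. -/
theorem exists_schwarzPick_factor {F : ℂ → ℂ} (hF : DifferentiableOn ℂ F upperHalf)
    (hm : MapsTo F upperHalf upperHalf) {w : ℂ} (hw : w ∈ upperHalf) :
    ∃ m : ℂ → ℂ, DifferentiableOn ℂ m upperHalf ∧ (∀ z ∈ upperHalf, ‖m z‖ ≤ 1) ∧
      ∀ z ∈ upperHalf, pseudo (F z) (F w) = pseudo z w * m z := by
  set g : ℂ → ℂ := fun y => pseudo (F (pseudoInv w y)) (F w) with hg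
  have hinv : MapsTo (pseudoInv w) (ball 0 1) upperHalf := fun y hy =>
    pseudoInv_mem hw (by simpa using hy)
  have hgd : DifferentiableOn ℂ g (ball 0 1) := by
    refine differentiableOn_pseudo (hF.comp ?_ hinv) (hm.comp hinv) (hm hw)
    refine DifferentiableOn.div (by fun_prop) (by fun_prop) fun y hy => ?_
    exact one_sub_ne_zero_of_norm_lt (by simpa using hy)
  have hg0 : g 0 = 0 := by simp [hg, pseudoInv, pseudo]
  have hgm : MapsTo g (ball 0 1) (closedBall (g 0) 1) := fun y hy => by
    rw [hg0, mem_closedBall_zero_iff]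
    exact (norm_pseudo_lt_one (hm (hinv hy)) (hm hw)).le
  have hps : MapsTo (fun z => pseudo z w) upperHalf (ball 0 1) := fun z hz => by
    simpa using norm_pseudo_lt_one hz hw
  -- The factor is `g y / y` with the singularity at `y = 0` removed, hence holomorphic at `z = w`
  -- too; the Schwarz lemma bounds it by 1.
  refine ⟨fun z => dslope g 0 (pseudo z w), ?_, fun z hz => ?_, fun z hz => ?_⟩
  · refine DifferentiableOn.comp (t := ball 0 1) ?_
      (differentiableOn_pseudo differentiableOn_id (mapsTo_id _) hw) hps
    exact (Complex.differentiableOn_dslope (ball_mem_nhds _ one_pos)).2 hgd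
  · simpa using Complex.norm_dslope_le_div_of_mapsTo_ball hgd hgm (hps hz)
  · have := sub_smul_dslope g 0 (pseudo z w)
    simp only [sub_zero, hg0, smul_eq_mul] at this
    rw [this, hg]
    simp only [pseudoInv_pseudo hz hw]

theorem norm_pseudo_map_le {F : ℂ → ℂ} (hF : DifferentiableOn ℂ F upperHalf)
    (hm : MapsTo F upperHalf upperHalf) {z w : ℂ} (hz : z ∈ upperHalf) (hw : w ∈ upperHalf) :
    ‖pseudo (F z) (F w)‖ ≤ ‖pseudo z w‖ := by
  obtain ⟨m, -, h1, h2⟩ := exists_schwarzPick_factor hF hm hw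
  rw [h2 z hz, norm_mul]
  exact mul_le_of_le_one_right (norm_nonneg _) (h1 z hz)

/-- A Harnack inequality for `1 - m`, where `|m| ≤ 1`. -/
theorem norm_one_sub_le {m : ℂ → ℂ} (hd : DifferentiableOn ℂ m upperHalf)
    (hm : ∀ z ∈ upperHalf, ‖m z‖ ≤ 1) {z p : ℂ} (hz : z ∈ upperHalf) (hp : p ∈ upperHalf) :
    (1 - ‖pseudo z p‖) * ‖1 - m z‖ ≤ (1 + ‖pseudo z p‖) * ‖1 - m p‖ := by
  set δ := ‖pseudo z p‖ with hδ
  have hδ0 : 0 ≤ δ := norm_nonneg _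
  have key : ∀ η : ℝ, 0 < η → ‖m z - m p‖ ≤ δ * (‖1 - m z‖ + ‖1 - m p‖ + 2 * η) := by
    intro η hη
    -- `1 - m` has nonnegative real part, and adding `η` makes it positive. Schwarz–Pick then
    -- applies to `F`, and `η` tends to 0 afterwards.
    set F : ℂ → ℂ := fun z => Complex.I * (1 - m z + η) with hFdef
    have hF : DifferentiableOn ℂ F upperHalf := by
      have : DifferentiableOn ℂ (fun z => 1 - m z + η) upperHalf :=
        ((differentiableOn_const _).sub hd).add (differentiableOn_const _)
      exact this.const_mul _
    have hFm : MapsTo F upperHalf upperHalf := fun y hy => by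
      change 0 < (Complex.I * (1 - m y + η)).im
      have := (Complex.re_le_norm (m y)).trans (hm y hy)
      simp
      linarith
    have h1 := norm_pseudo_map_le hF hFm hz hp
    have h2 := norm_pos_iff.2 (sub_conj_ne_zero (hFm hz) (hFm hp))
    rw [pseudo, norm_div, div_le_iff₀ h2] at h1
    have e1 : F z - F p = -Complex.I * (m z - m p) := by simp only [hFdef]; ring
    have e2 : F z - conj (F p) = Complex.I * ((1 - m z) + conj (1 - m p) + (2 * η : ℝ)) := by
      simp only [hFdef, map_mul, map_add, map_sub, map_one, Complex.conj_I, Complex.conj_ofReal]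
      push_cast
      ring
    rw [e1, e2, norm_mul, norm_mul, norm_neg, Complex.norm_I, one_mul, one_mul] at h1
    refine h1.trans (mul_le_mul_of_nonneg_left ?_ hδ0)
    refine (norm_add_le _ _).trans (add_le_add ((norm_add_le _ _).trans ?_) ?_)
    · rw [Complex.norm_conj]
    · rw [Complex.norm_real, Real.norm_of_nonneg (by positivity)]
  have key' : ‖m z - m p‖ ≤ δ * (‖1 - m z‖ + ‖1 - m p‖) := by
    refine le_of_forall_pos_le_add fun ε hε => ?_
    refine (key (ε / (2 * (δ + 1))) (by positivity)).trans ?_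
    rw [mul_add]
    gcongr
    rw [show δ * (2 * (ε / (2 * (δ + 1)))) = ε * (δ / (δ + 1)) by field_simp]
    exact mul_le_of_le_one_right hε.le ((div_le_one (by positivity)).2 (by linarith))
  have : ‖1 - m z‖ ≤ ‖1 - m p‖ + ‖m z - m p‖ := by
    rw [norm_sub_rev (m z)]
    simpa using norm_add_le (1 - m p) (m p - m z)
  nlinarith

/-- By `norm_sub_conj_sq`, `1 - |pseudo|²` equals `4 Im z Im w / |z - conj w|²`. This keeps the
constant in `norm_one_sub_le` bounded on compact sets. -/
theorem norm_pseudo_le_of_bounds {c M : ℝ} (hc : 0 < c) {z w : ℂ} (hz : c ≤ z.im)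
    (hw : c ≤ w.im) (hzM : ‖z‖ ≤ M) (hwM : ‖w‖ ≤ M) :
    c ^ 2 / (2 * M ^ 2) ≤ 1 - ‖pseudo z w‖ := by
  have hz0 : z ∈ upperHalf := hc.trans_le hz
  have hw0 : w ∈ upperHalf := hc.trans_le hw
  have hM : 0 < M := hc.trans_le ((hz.trans ((le_abs_self _).trans (Complex.abs_im_le_norm z))).trans hzM)
  have hpos := norm_pos_iff.2 (sub_conj_ne_zero hz0 hw0)
  have h1 := norm_pseudo_lt_one hz0 hw0
  have h0 := norm_nonneg (pseudo z w)
  have h2 : ‖z - conj w‖ ≤ 2 * M := by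
    refine (norm_sub_le _ _).trans ?_
    rw [Complex.norm_conj]; linarith
  have h3 : ‖pseudo z w‖ * ‖z - conj w‖ = ‖z - w‖ := by
    rw [pseudo, norm_div, div_mul_cancel₀ _ hpos.ne']
  have h4 := norm_sub_conj_sq z w
  rw [← h3] at h4
  have h5 : c ^ 2 ≤ z.im * w.im := by nlinarith
  have h6 : (1 - ‖pseudo z w‖ ^ 2) * ‖z - conj w‖ ^ 2 = 4 * (z.im * w.im) := by linarith
  have h7 : ‖z - conj w‖ ^ 2 ≤ (2 * M) ^ 2 := by gcongr
  have h8 : 4 * c ^ 2 ≤ (1 - ‖pseudo z w‖ ^ 2) * (2 * M) ^ 2 := by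
    have : (1 - ‖pseudo z w‖ ^ 2) * ‖z - conj w‖ ^ 2 ≤ (1 - ‖pseudo z w‖ ^ 2) * (2 * M) ^ 2 := by
      gcongr; nlinarith
    linarith
  rw [div_le_iff₀ (by positivity)]
  nlinarith [mul_nonneg (mul_nonneg h0 (sub_nonneg.2 h1.le)) (sq_nonneg M), sq_nonneg M]

/-- The right side is real-linear in the displacements `z' - z` and `w' - w`. It serves both ways:
to bound the change of the quotient, and to recover `z' - z` from that change. -/
theorem pseudo_sub_pseudo {z w z' w' : ℂ} (h : z - conj w ≠ 0) (h' : z' - conj w' ≠ 0) :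
    (pseudo z' w' - pseudo z w) * ((z - conj w) * (z' - conj w')) =
      (z' - z) * (w - conj w) - (w' - w) * (z - conj w) + conj (w' - w) * (z - w) := by
  rw [pseudo, pseudo, map_sub]
  field_simp
  ring

theorem im_add_im_le_norm_sub_conj (z w : ℂ) : z.im + w.im ≤ ‖z - conj w‖ := by
  refine le_trans (le_of_eq ?_) ((le_abs_self _).trans (Complex.abs_im_le_norm _))
  simp

theorem norm_sub_conj_le (z w : ℂ) : ‖z - conj w‖ ≤ ‖z‖ + ‖w‖ :=
  (norm_sub_le _ _).trans_eq (by rw [Complex.norm_conj])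

/-- A holomorphic self-map of the upper half-plane which nearly fixes two points is close to the
identity on compact sets, at a linear rate. -/
theorem exists_two_point_bound {c M κ : ℝ} (hc : 0 < c) (hM : 0 < M) (hκ : 0 < κ) :
    ∃ C η : ℝ, 0 < C ∧ 0 < η ∧ ∀ F : ℂ → ℂ, DifferentiableOn ℂ F upperHalf →
      MapsTo F upperHalf upperHalf → ∀ z w p : ℂ, c ≤ z.im → c ≤ w.im → c ≤ p.im →
      ‖z‖ ≤ M → ‖w‖ ≤ M → ‖p‖ ≤ M → κ ≤ ‖w - p‖ → ∀ ε ≤ η, ‖F w - w‖ ≤ ε → ‖F p - p‖ ≤ ε →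
      ‖F z - z‖ ≤ C * ε := by
  -- A product of three losses: `6M/c²` for the quotient at `p`, `2M/κ` for dividing by `pseudo p
  -- w`, and `2 · 2M²/c²` for Harnack.
  set A : ℝ := 48 * M ^ 4 / (c ^ 4 * κ) with hA
  have hA0 : 0 < A := by positivity
  -- `ε ≤ c/2` keeps the images of `w` and `p` at height at least `c/2`; `2AMε ≤ c` lets the term in
  -- `‖F z - z‖` on the right of `hfin` be absorbed on the left.
  refine ⟨(4 * A * M ^ 2 + c + 4 * M) / c, min (c / 2) (c / (2 * A * M)), by positivity,
    lt_min (by positivity) (by positivity), ?_⟩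
  intro F hF hm z w p hz hw hp hzM hwM hpM hwp ε hε hFw hFp
  have hε0 : 0 ≤ ε := (norm_nonneg _).trans hFw
  have hε1 : ε ≤ c / 2 := hε.trans (min_le_left _ _)
  have hε2 : 2 * A * M * ε ≤ c := by
    have := hε.trans (min_le_right _ _)
    rw [le_div_iff₀ (by positivity)] at this
    linarith
  have hz0 : z ∈ upperHalf := hc.trans_le hz
  have hw0 : w ∈ upperHalf := hc.trans_le hw
  have hp0 : p ∈ upperHalf := hc.trans_le hp
  -- Since `F` nearly fixes `w` and `p`, `m p` is close to 1. Harnack carries this to `m z`, so the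
  -- quotient at `z` hardly changes, and neither does `z`.
  obtain ⟨m, hmd, hm1, hmeq⟩ := exists_schwarzPick_factor hF hm hw0
  have hww : ‖w - conj w‖ ≤ 2 * M := (norm_sub_conj_le w w).trans (by linarith)
  have hpw : ‖p - conj w‖ ≤ 2 * M := (norm_sub_conj_le p w).trans (by linarith)
  have hzw : ‖z - conj w‖ ≤ 2 * M := (norm_sub_conj_le z w).trans (by linarith)
  have hpw' : ‖p - w‖ ≤ 2 * M := (norm_sub_le p w).trans (by linarith)
  have hzw' : ‖z - w‖ ≤ 2 * M := (norm_sub_le z w).trans (by linarith)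
  have him : ∀ q : ℂ, c ≤ q.im → ‖F q - q‖ ≤ ε → c / 2 ≤ (F q).im := fun q hq h => by
    have := (abs_le.1 ((Complex.abs_im_le_norm (F q - q)).trans h)).1
    rw [Complex.sub_im] at this
    linarith
  have hΔp : ‖pseudo (F p) (F w) - pseudo p w‖ ≤ 6 * M * ε / c ^ 2 := by
    have h := congrArg norm (pseudo_sub_pseudo (sub_conj_ne_zero hp0 hw0)
      (sub_conj_ne_zero (hm hp0) (hm hw0)))
    have h1 : 2 * c ≤ ‖p - conj w‖ := le_trans (by linarith) (im_add_im_le_norm_sub_conj p w)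
    have h2 : c ≤ ‖F p - conj (F w)‖ :=
      le_trans (by linarith [him p hp hFp, him w hw hFw]) (im_add_im_le_norm_sub_conj _ _)
    have h3 : ‖(F p - p) * (w - conj w) - (F w - w) * (p - conj w) + conj (F w - w) * (p - w)‖
        ≤ ε * (2 * M) + ε * (2 * M) + ε * (2 * M) := by
      refine (norm_add_le _ _).trans (add_le_add ((norm_sub_le _ _).trans (add_le_add ?_ ?_)) ?_)
      all_goals rw [norm_mul]
      all_goals try rw [Complex.norm_conj]
      all_goals gcongr
    rw [← h, norm_mul, norm_mul] at h3
    have h4 : c * c ≤ ‖p - conj w‖ * ‖F p - conj (F w)‖ := by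
      apply mul_le_mul _ h2 hc.le (norm_nonneg _); linarith
    rw [le_div_iff₀ (by positivity)]
    have := mul_le_mul_of_nonneg_left h4 (norm_nonneg (pseudo (F p) (F w) - pseudo p w))
    nlinarith
  have hbp : κ / (2 * M) ≤ ‖pseudo p w‖ := by
    have h := norm_pos_iff.2 (sub_conj_ne_zero hp0 hw0)
    rw [pseudo, norm_div, norm_sub_rev]
    gcongr
  have h1p : ‖1 - m p‖ ≤ 12 * M ^ 2 * ε / (c ^ 2 * κ) := by
    have e : pseudo (F p) (F w) - pseudo p w = -(pseudo p w * (1 - m p)) := by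
      rw [hmeq p hp0]; ring
    rw [e, norm_neg, norm_mul] at hΔp
    have := (mul_le_mul_of_nonneg_right hbp (norm_nonneg (1 - m p))).trans hΔp
    rw [div_mul_eq_mul_div, div_le_div_iff₀ (by positivity) (by positivity)] at this
    rw [le_div_iff₀ (by positivity)]
    linarith
  have hΔz : ‖pseudo (F z) (F w) - pseudo z w‖ ≤ A * ε := by
    have e : pseudo (F z) (F w) - pseudo z w = -(pseudo z w * (1 - m z)) := by
      rw [hmeq z hz0]; ring
    rw [e, norm_neg, norm_mul]
    refine (mul_le_of_le_one_left (norm_nonneg _) (norm_pseudo_lt_one hz0 hw0).le).trans ?_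
    have h1 := norm_one_sub_le hmd hm1 hz0 hp0
    have h2 := norm_pseudo_le_of_bounds hc hz hp hzM hpM
    have h3 := norm_pseudo_lt_one hz0 hp0
    have h4 : (1 + ‖pseudo z p‖) * ‖1 - m p‖ ≤ 2 * (12 * M ^ 2 * ε / (c ^ 2 * κ)) := by
      gcongr; linarith
    have h5 := ((mul_le_mul_of_nonneg_right h2 (norm_nonneg (1 - m z))).trans h1).trans h4
    rw [hA]
    rw [div_mul_eq_mul_div, div_le_iff₀ (by positivity)] at h5
    have h6 : 2 * (12 * M ^ 2 * ε / (c ^ 2 * κ)) * (2 * M ^ 2) =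
        c ^ 2 * (48 * M ^ 4 / (c ^ 4 * κ) * ε) := by field_simp; ring
    rw [h6] at h5
    exact le_of_mul_le_mul_left h5 (by positivity)
  set e := F z - z with he
  have hfin : ‖e‖ * (2 * c) ≤ A * ε * (2 * M * (2 * M + ‖e‖ + ε)) + 2 * M * ε + 2 * M * ε := by
    have h := pseudo_sub_pseudo (sub_conj_ne_zero hz0 hw0)
      (sub_conj_ne_zero (hm hz0) (hm hw0))
    have h' : e * (w - conj w) = (pseudo (F z) (F w) - pseudo z w) *
        ((z - conj w) * (F z - conj (F w))) + (F w - w) * (z - conj w)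
        - conj (F w - w) * (z - w) := by rw [h]; ring
    have h1 : 2 * c ≤ ‖w - conj w‖ := le_trans (by linarith) (im_add_im_le_norm_sub_conj w w)
    have h2 : ‖F z - conj (F w)‖ ≤ 2 * M + ‖e‖ + ε := by
      have : F z - conj (F w) = (z - conj w) + e - conj (F w - w) := by
        rw [he, map_sub]; ring
      rw [this]
      refine (norm_sub_le _ _).trans (add_le_add ((norm_add_le _ _).trans ?_) ?_)
      · gcongr
      · rwa [Complex.norm_conj]
    refine (mul_le_mul_of_nonneg_left h1 (norm_nonneg e)).trans ?_
    rw [← norm_mul, h']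
    refine (norm_sub_le _ _).trans (add_le_add ((norm_add_le _ _).trans (add_le_add ?_ ?_)) ?_)
    · rw [norm_mul, norm_mul]
      gcongr
    · rw [norm_mul, mul_comm]
      gcongr
    · rw [norm_mul, mul_comm, Complex.norm_conj]
      gcongr
  rw [div_mul_eq_mul_div, le_div_iff₀ hc]
  have h1 := mul_le_mul_of_nonneg_right hε2 (norm_nonneg e)
  have h2 := mul_le_mul_of_nonneg_right hε2 hε0
  nlinarith

/-- `|pseudo z w|` is `tanh` of half the hyperbolic distance, and `artanh` is monotone. -/
theorem dist_map_le {F : ℂ → ℂ} (hF : DifferentiableOn ℂ F upperHalf)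
    (hm : MapsTo F upperHalf upperHalf) (z w : UpperHalfPlane) :
    dist (⟨F z, hm z.im_pos⟩ : UpperHalfPlane) ⟨F w, hm w.im_pos⟩ ≤ dist z w := by
  have h := norm_pseudo_map_le hF hm z.im_pos w.im_pos
  simp only [pseudo, norm_div, ← Complex.dist_eq] at h
  have h1 := UpperHalfPlane.tanh_half_dist z w
  have h2 := UpperHalfPlane.tanh_half_dist ⟨F z, hm z.im_pos⟩ ⟨F w, hm w.im_pos⟩
  have h3 := (h2.le.trans h).trans h1.ge
  have h4 := Real.artanh_le_artanh (Real.neg_one_lt_tanh _) (Real.tanh_lt_one _) h3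
  rw [Real.artanh_tanh, Real.artanh_tanh] at h4
  linarith

/-! ### Integral bounds, lifts through `exp`, and joint continuity. -/

/-- Increments of `K` telescope, so chaining short intervals costs nothing in the constant. -/
theorem norm_sub_le_of_local {E : Type*} [SeminormedAddCommGroup E] {g : ℝ → E} {K : ℝ → ℝ}
    {a b δ : ℝ} (hδ : 0 < δ)
    (h : ∀ u t, a ≤ u → u ≤ t → t ≤ b → t - u ≤ δ → ‖g t - g u‖ ≤ K t - K u) :
    ∀ u t, a ≤ u → u ≤ t → t ≤ b → ‖g t - g u‖ ≤ K t - K u := by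
  have key : ∀ n : ℕ, ∀ u t, a ≤ u → u ≤ t → t ≤ b → t - u ≤ n * δ → ‖g t - g u‖ ≤ K t - K u := by
    intro n
    induction n with
    | zero =>
      intro u t hu hut ht hn
      refine h u t hu hut ht ?_
      simp only [Nat.cast_zero, zero_mul] at hn
      linarith
    | succ n ih =>
      intro u t hu hut ht hn
      by_cases hd : t - u ≤ δ
      · exact h u t hu hut ht hd
      · push Not at hd
        push_cast at hn
        have h1 := ih u (t - δ) hu (by linarith) (by linarith) (by linarith)
        have h2 := h (t - δ) t (by linarith) (by linarith) ht (by linarith)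
        have h3 := norm_add_le (g t - g (t - δ)) (g (t - δ) - g u)
        rw [sub_add_sub_cancel] at h3
        linarith
  intro u t hu hut ht
  obtain ⟨n, hn⟩ := exists_nat_ge ((t - u) / δ)
  exact key n u t hu hut ht ((div_le_iff₀ hδ).1 hn)

theorem exists_delta_of_continuousOn {E : Type*} [SeminormedAddCommGroup E] {g : ℝ → E} {a b ε : ℝ}
    (hg : ContinuousOn g (Icc a b)) (hε : 0 < ε) :
    ∃ δ, 0 < δ ∧ ∀ u t, a ≤ u → u ≤ t → t ≤ b → t - u ≤ δ → ‖g t - g u‖ ≤ ε := by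
  have hu := isCompact_Icc.uniformContinuousOn_of_continuous hg
  obtain ⟨δ, hδ, h⟩ := Metric.uniformContinuousOn_iff_le.1 hu ε hε
  refine ⟨δ, hδ, fun u t h1 h2 h3 h4 => ?_⟩
  rw [← dist_eq_norm]
  refine h t ⟨h1.trans h2, h3⟩ u ⟨h1, h2.trans h3⟩ ?_
  rwa [Real.dist_eq, abs_of_nonneg (by linarith)]

/-- For `|x| ≤ 1/2` one has `|exp x - 1| ≥ |x|/2`, which inverts `exp` on short time intervals;
`norm_sub_le_of_local` removes the shortness. -/
theorem norm_sub_le_of_exp {g : ℝ → ℂ} {K : ℝ → ℝ} {a b ρ : ℝ} (hρ : 0 < ρ)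
    (hg : ContinuousOn g (Icc a b)) (hb : ∀ t ∈ Icc a b, ρ ≤ ‖Complex.exp (g t)‖)
    (h : ∀ u t, a ≤ u → u ≤ t → t ≤ b → ‖Complex.exp (g t) - Complex.exp (g u)‖ ≤ K t - K u) :
    ∀ u t, a ≤ u → u ≤ t → t ≤ b → ‖g t - g u‖ ≤ 2 / ρ * (K t - K u) := by
  obtain ⟨δ, hδ, hδg⟩ := exists_delta_of_continuousOn hg (ε := 1 / 2) (by norm_num)
  have key := norm_sub_le_of_local (g := g) (K := fun t => 2 / ρ * K t) (a := a) (b := b) hδ ?_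
  · intro u t h1 h2 h3
    rw [mul_sub]
    exact key u t h1 h2 h3
  intro u t h1 h2 h3 h4
  have h5 := hδg u t h1 h2 h3 h4
  have h6 := Complex.norm_exp_sub_one_sub_id_le (x := g t - g u) (by linarith)
  have h7 := h u t h1 h2 h3
  have h8 : Complex.exp (g t) - Complex.exp (g u) =
      Complex.exp (g u) * (Complex.exp (g t - g u) - 1) := by
    rw [mul_sub, ← Complex.exp_add]; ring_nf
  rw [h8, norm_mul] at h7
  have h9 : ‖g t - g u‖ / 2 ≤ ‖Complex.exp (g t - g u) - 1‖ := by
    have := norm_sub_norm_le (g t - g u) (g t - g u - (Complex.exp (g t - g u) - 1))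
    rw [sub_sub_cancel, norm_sub_rev _ (Complex.exp (g t - g u) - 1)] at this
    nlinarith [norm_nonneg (g t - g u)]
  have h10 := mul_le_mul (hb u ⟨h1, h2.trans h3⟩) h9 (by positivity) (norm_nonneg _)
  rw [← mul_sub, div_mul_eq_mul_div, le_div_iff₀ hρ]
  linarith

theorem eqOn_of_exp_eq {X : Type*} [TopologicalSpace X] {S : Set X} (hS : IsPreconnected S)
    {f g : X → ℂ} (hf : ContinuousOn f S) (hg : ContinuousOn g S)
    (h : ∀ x ∈ S, Complex.exp (f x) = Complex.exp (g x)) {a : X} (ha : a ∈ S) (hfg : f a = g a) :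
    EqOn f g S :=
  Complex.isCoveringMap_exp.eqOn_of_comp_eqOn hS hf hg (fun x hx => Subtype.ext (h x hx)) ha hfg

theorem differentiableOn_of_exp {f : ℂ → ℂ} {U : Set ℂ} (hU : IsOpen U) (hf : ContinuousOn f U)
    (hd : DifferentiableOn ℂ (fun z => Complex.exp (f z)) U) : DifferentiableOn ℂ f U := by
  intro z hz
  have hfz := hf.continuousAt (hU.mem_nhds hz)
  have hdz := hd.differentiableAt (hU.mem_nhds hz)
  have hev : f =ᶠ[𝓝 z] fun y => f z + Complex.log (Complex.exp (f y) / Complex.exp (f z)) := by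
    have him : Tendsto (fun y => (f y - f z).im) (𝓝 z) (𝓝 0) := by
      have : ContinuousAt (fun y => (f y - f z).im) z :=
        Complex.continuous_im.continuousAt.comp (hfz.sub continuousAt_const)
      simpa [ContinuousAt] using this
    filter_upwards [him.eventually (Ioo_mem_nhds (neg_lt_zero.2 Real.pi_pos) Real.pi_pos)] with y hy
    rw [← Complex.exp_sub, Complex.log_exp hy.1 hy.2.le, add_sub_cancel]
  refine (DifferentiableAt.congr_of_eventuallyEq ?_ hev).differentiableWithinAt
  refine DifferentiableAt.const_add _ (DifferentiableAt.clog (hdz.div_const _) ?_)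
  rw [div_self (Complex.exp_ne_zero _)]
  exact Complex.one_mem_slitPlane

theorem continuousOn_Ici_of_integral_bound {p : ℝ → ℂ} {s : ℝ}
    (h : ∀ T, s ≤ T → ∃ k : ℝ → ℝ, IntegrableOn k (Icc s T) ∧
      ∀ u t, s ≤ u → u ≤ t → t ≤ T → ‖p u - p t‖ ≤ ∫ ξ in u..t, k ξ) :
    ContinuousOn p (Ici s) := by
  intro x hx
  obtain ⟨k, hk, hb⟩ := h (x + 1) (by have : s ≤ x := hx; linarith)
  have hx' : s ≤ x := hx
  have hkii : ∀ u t, u ∈ Icc s (x + 1) → t ∈ Icc s (x + 1) → IntervalIntegrable k volume u t :=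
    fun u t hu ht => by
      refine (hk.mono_set ?_).intervalIntegrable
      exact uIcc_subset_Icc hu ht
  have hsmem : s ∈ Icc s (x + 1) := ⟨le_rfl, by linarith⟩
  have hcont : ContinuousOn (fun t => ∫ ξ in s..t, k ξ) (Icc s (x + 1)) :=
    by
      have hle : s ≤ x + 1 := by linarith
      have := intervalIntegral.continuousOn_primitive_interval (μ := volume) (f := k) (a := s)
        (b := x + 1) (by rwa [uIcc_of_le hle])
      rwa [uIcc_of_le hle] at this
  have hxm : x ∈ Icc s (x + 1) := ⟨hx', by linarith⟩
  have hbd : ∀ y ∈ Icc s (x + 1), ‖p y - p x‖ ≤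
      |(∫ ξ in s..y, k ξ) - ∫ ξ in s..x, k ξ| := by
    intro y hy
    rcases le_total y x with hyx | hxy
    · have := hb y x hy.1 hyx (by linarith)
      rw [abs_sub_comm, intervalIntegral.integral_interval_sub_left (hkii _ _ hsmem hxm)
        (hkii _ _ hsmem hy)]
      exact this.trans (le_abs_self _)
    · have := hb x y hx' hxy hy.2
      rw [norm_sub_rev, intervalIntegral.integral_interval_sub_left (hkii _ _ hsmem hy)
        (hkii _ _ hsmem hxm)]
      exact this.trans (le_abs_self _)
  have hlim : Tendsto (fun y => |(∫ ξ in s..y, k ξ) - ∫ ξ in s..x, k ξ|)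
      (𝓝[Icc s (x + 1)] x) (𝓝 0) := by
    have := ((hcont x hxm).tendsto.sub_const (∫ ξ in s..x, k ξ)).abs
    simpa using this
  have hc : ContinuousWithinAt p (Icc s (x + 1)) x := by
    rw [ContinuousWithinAt, tendsto_iff_norm_sub_tendsto_zero]
    refine squeeze_zero' (Eventually.of_forall fun _ => norm_nonneg _) ?_ hlim
    filter_upwards [self_mem_nhdsWithin] with y hy using hbd y hy
  refine hc.mono_of_mem_nhdsWithin ?_
  filter_upwards [self_mem_nhdsWithin, mem_nhdsWithin_of_mem_nhds (Iio_mem_nhds (lt_add_one x))]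
    with y hy hy' using ⟨hy, le_of_lt hy'⟩

theorem _root_.MeasureTheory.MemLp.integrableOn_Icc {d : ℝ≥0∞} (hd : 1 ≤ d) {k : ℝ → ℝ} {a b : ℝ}
    (hk : MemLp k d (volume.restrict (Icc a b))) : IntegrableOn k (Icc a b) :=
  hk.integrable hd

theorem isOpen_strip : IsOpen strip :=
  (isOpen_lt continuous_const Complex.continuous_re).inter
    (isOpen_lt Complex.continuous_re continuous_const)

theorem convex_strip : Convex ℝ strip :=
  (convex_halfSpace_re_gt 0).inter (convex_halfSpace_re_lt 1)

/-- Boundedness makes the maps `z ↦ G z t` Lipschitz near each point uniformly in `t`, by the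
Schwarz lemma; this upgrades separate continuity to joint continuity. -/
theorem continuousOn_of_separately {G : ℂ → ℝ → ℂ} {U : Set ℂ} {S : Set ℝ} (hU : IsOpen U)
    (hd : ∀ t ∈ S, DifferentiableOn ℂ (fun z => G z t) U) (hb : ∀ z ∈ U, ∀ t ∈ S, ‖G z t‖ ≤ 1)
    (hc : ∀ z ∈ U, ContinuousOn (G z) S) :
    ContinuousOn (fun q : ℂ × ℝ => G q.1 q.2) (U ×ˢ S) := by
  rintro ⟨z₀, t₀⟩ ⟨hz₀ : z₀ ∈ U, ht₀ : t₀ ∈ S⟩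
  obtain ⟨R, hR, hRU⟩ := Metric.isOpen_iff.1 hU z₀ hz₀
  rw [ContinuousWithinAt, tendsto_iff_dist_tendsto_zero]
  have hbd : ∀ᶠ q : ℂ × ℝ in 𝓝[U ×ˢ S] (z₀, t₀), dist (G q.1 q.2) (G z₀ t₀) ≤
      2 / R * dist q.1 z₀ + dist (G z₀ q.2) (G z₀ t₀) := by
    have h1 : ∀ᶠ q : ℂ × ℝ in 𝓝[U ×ˢ S] (z₀, t₀), q.1 ∈ ball z₀ R :=
      mem_nhdsWithin_of_mem_nhds (continuous_fst.continuousAt.preimage_mem_nhds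
        (ball_mem_nhds z₀ hR))
    filter_upwards [h1, self_mem_nhdsWithin] with q hq hqS
    refine (dist_triangle _ (G z₀ q.2) _).trans (add_le_add_left ?_ _)
    refine Complex.dist_le_div_mul_dist_of_mapsTo_ball (f := fun z => G z q.2)
      ((hd q.2 hqS.2).mono hRU) (fun z hz => ?_) hq
    rw [mem_closedBall, dist_eq_norm]
    exact (norm_sub_le _ _).trans (by linarith [hb z (hRU hz) q.2 hqS.2, hb z₀ hz₀ q.2 hqS.2])
  refine squeeze_zero' (Eventually.of_forall fun _ => dist_nonneg) hbd ?_
  have l1 : Tendsto (fun q : ℂ × ℝ => dist q.1 z₀) (𝓝[U ×ˢ S] (z₀, t₀)) (𝓝 0) := by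
    have : Continuous fun q : ℂ × ℝ => dist q.1 z₀ := by fun_prop
    have h := (this.tendsto (z₀, t₀)).mono_left (nhdsWithin_le_nhds (s := U ×ˢ S))
    simpa using h
  have l2 : Tendsto (fun q : ℂ × ℝ => dist (G z₀ q.2) (G z₀ t₀)) (𝓝[U ×ˢ S] (z₀, t₀)) (𝓝 0) := by
    have h : ContinuousWithinAt (fun q : ℂ × ℝ => G z₀ q.2) (U ×ˢ S) (z₀, t₀) :=
      ContinuousWithinAt.comp (t := S) (hc z₀ hz₀ t₀ ht₀) continuous_snd.continuousWithinAt
        fun q hq => hq.2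
    exact tendsto_iff_dist_tendsto_zero.1 h
  simpa using (l1.const_mul (2 / R)).add l2

/-! ### The radii and the covering maps of the annuli. -/

section System

variable {d : ℝ≥0∞} {r : ℝ → ℝ}

theorem IsCanonicalSystem.radius_pos (hr : IsCanonicalSystem d r) (hnd : IsNondegenerate r)
    {t : ℝ} (ht : 0 ≤ t) : 0 < r t :=
  lt_of_le_of_ne (hr.mem_Ico t ht).1 (hnd t ht).symm

theorem IsCanonicalSystem.log_neg (hr : IsCanonicalSystem d r) (hnd : IsNondegenerate r)
    {t : ℝ} (ht : 0 ≤ t) : Real.log (r t) < 0 :=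
  Real.log_neg (hr.radius_pos hnd ht) (hr.mem_Ico t ht).2

theorem omega_eq_of_nondegenerate (hnd : IsNondegenerate r) {t : ℝ} (ht : 0 ≤ t) :
    omega (r t) = -Real.pi / Real.log (r t) := if_neg (hnd t ht)

theorem inv_log_eq (hnd : IsNondegenerate r) {t : ℝ} (ht : 0 ≤ t) :
    (Real.log (r t))⁻¹ = -omega (r t) / Real.pi := by
  rw [omega_eq_of_nondegenerate hnd ht]
  field_simp [Real.pi_ne_zero]

theorem IsCanonicalSystem.inv_log_mono (hr : IsCanonicalSystem d r) (hnd : IsNondegenerate r)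
    {s t : ℝ} (hs : 0 ≤ s) (hst : s ≤ t) : (Real.log (r s))⁻¹ ≤ (Real.log (r t))⁻¹ := by
  rw [inv_log_eq hnd hs, inv_log_eq hnd (hs.trans hst)]
  have := hr.antitone (show s ∈ Ici 0 from hs) (show t ∈ Ici 0 from hs.trans hst) hst
  simp only at this
  gcongr

theorem IsCanonicalSystem.log_anti (hr : IsCanonicalSystem d r) (hnd : IsNondegenerate r)
    {s t : ℝ} (hs : 0 ≤ s) (hst : s ≤ t) : Real.log (r t) ≤ Real.log (r s) :=
  (inv_le_inv_of_neg (hr.log_neg hnd hs) (hr.log_neg hnd (hs.trans hst))).1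
    (hr.inv_log_mono hnd hs hst)

theorem IsCanonicalSystem.radius_anti (hr : IsCanonicalSystem d r) (hnd : IsNondegenerate r)
    {s t : ℝ} (hs : 0 ≤ s) (hst : s ≤ t) : r t ≤ r s :=
  (Real.log_le_log_iff (hr.radius_pos hnd (hs.trans hst)) (hr.radius_pos hnd hs)).1
    (hr.log_anti hnd hs hst)

theorem IsCanonicalSystem.annulus_subset (hr : IsCanonicalSystem d r) (hnd : IsNondegenerate r)
    {s t : ℝ} (hs : 0 ≤ s) (hst : s ≤ t) : annulus (r s) ⊆ annulus (r t) :=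
  fun _ hz => ⟨(hr.radius_anti hnd hs hst).trans_lt hz.1, hz.2⟩

theorem IsCanonicalSystem.continuousOn_log (hr : IsCanonicalSystem d r)
    (hnd : IsNondegenerate r) : ContinuousOn (fun t => Real.log (r t)) (Ici 0) := by
  have h1 : ContinuousOn (fun t => omega (r t)) (Ici 0) := by
    intro x hx
    have hx' : (0 : ℝ) ≤ x := hx
    have h := (hr.ac 0 (x + 1) (by linarith) Icc_subset_Ici_self).1.continuousOn
    rw [uIcc_of_le (by linarith)] at h
    refine (h x ⟨hx', by linarith⟩).mono_of_mem_nhdsWithin ?_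
    filter_upwards [self_mem_nhdsWithin, mem_nhdsWithin_of_mem_nhds (Iio_mem_nhds (lt_add_one x))]
      with y hy hy' using ⟨hy, le_of_lt hy'⟩
  have h2 : ContinuousOn (fun t => (-omega (r t) / Real.pi)⁻¹) (Ici 0) := by
    refine (h1.neg.div_const _).inv₀ fun t ht => ?_
    change -omega (r t) / Real.pi ≠ 0
    rw [← inv_log_eq hnd ht]
    exact inv_ne_zero (hr.log_neg hnd ht).ne
  refine h2.congr fun t ht => ?_
  change _ = (-omega (r t) / Real.pi)⁻¹
  rw [← inv_log_eq hnd ht, inv_inv]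

theorem norm_stripMap (r : ℝ → ℝ) (t : ℝ) (ζ : ℂ) :
    ‖stripMap r t ζ‖ = Real.exp (ζ.re * Real.log (r t)) := by
  rw [stripMap, Complex.norm_exp, Complex.re_mul_ofReal]

/-- The left-to-right implication is what makes every lift map the strip into itself. -/
theorem IsCanonicalSystem.stripMap_mem_iff (hr : IsCanonicalSystem d r) (hnd : IsNondegenerate r)
    {t : ℝ} (ht : 0 ≤ t) (ζ : ℂ) : stripMap r t ζ ∈ annulus (r t) ↔ ζ ∈ strip := by
  have hl := hr.log_neg hnd ht
  have hp := hr.radius_pos hnd ht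
  rw [annulus, strip, mem_ofPred_eq, mem_ofPred_eq, norm_stripMap, Real.exp_lt_one_iff,
    ← Real.log_lt_iff_lt_exp hp]
  constructor
  · rintro ⟨h1, h2⟩
    constructor <;> nlinarith
  · rintro ⟨h1, h2⟩
    constructor <;> nlinarith

theorem differentiable_stripMap (r : ℝ → ℝ) (t : ℝ) : Differentiable ℂ (stripMap r t) := by
  unfold stripMap; fun_prop

/-- Multiplication by the continuous nonzero function `log r(t)` turns both paths into lifts of one
path through the covering map `exp`. -/
theorem IsCanonicalSystem.eqOn_of_stripMap_eq (hr : IsCanonicalSystem d r)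
    (hnd : IsNondegenerate r) {s : ℝ} (hs : 0 ≤ s) {p q : ℝ → ℂ} (hp : ContinuousOn p (Ici s))
    (hq : ContinuousOn q (Ici s)) (h : ∀ t, s ≤ t → stripMap r t (p t) = stripMap r t (q t))
    (hpq : p s = q s) : EqOn p q (Ici s) := by
  have hl : ContinuousOn (fun t => ((Real.log (r t) : ℝ) : ℂ)) (Ici s) :=
    Complex.continuous_ofReal.comp_continuousOn
      ((hr.continuousOn_log hnd).mono (Ici_subset_Ici.2 hs))
  have key := eqOn_of_exp_eq isPreconnected_Ici (hp.mul hl) (hq.mul hl) h (self_mem_Ici) (by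
    simp only [Pi.mul_apply, hpq])
  intro t ht
  refine mul_right_cancel₀ (b := ((Real.log (r t) : ℝ) : ℂ)) ?_ (key ht)
  exact_mod_cast (hr.log_neg hnd (hs.trans ht)).ne

end System

/-! ### Construction of the lift. -/

section Lift

variable {d : ℝ≥0∞} {r : ℝ → ℝ} {φ : ℝ → ℝ → ℂ → ℂ}

theorem IsEvolutionFamilyOver.continuousOn (hd : 1 ≤ d) (hφ : IsEvolutionFamilyOver d r φ)
    {s : ℝ} (hs : 0 ≤ s) {z : ℂ} (hz : z ∈ annulus (r s)) :
    ContinuousOn (fun t => φ s t z) (Ici s) :=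
  continuousOn_Ici_of_integral_bound fun T hT => by
    obtain ⟨k, -, hk, hb⟩ := hφ.ef3 s T hs hT z hz
    exact ⟨k, hk.integrableOn_Icc hd, fun u t h1 h2 h3 => hb s u t le_rfl h1 h2 h3⟩

theorem IsEvolutionFamilyIn.continuousOn (hd : 1 ≤ d) {D : Set ℂ} {Ψ : ℝ → ℝ → ℂ → ℂ}
    (hΨ : IsEvolutionFamilyIn d D Ψ) {s : ℝ} (hs : 0 ≤ s) {z : ℂ} (hz : z ∈ D) :
    ContinuousOn (fun t => Ψ s t z) (Ici s) :=
  continuousOn_Ici_of_integral_bound fun T hT => by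
    obtain ⟨k, -, hk, hb⟩ := hΨ.ef3 (T + 1) (by linarith) z hz
    refine ⟨k, (hk.integrableOn_Icc hd).mono_set (Icc_subset_Icc hs (by linarith)),
      fun u t h1 h2 h3 => ?_⟩
    rw [norm_sub_rev]
    exact hb s u t hs h1 h2 (by linarith)

/-- Lifting the maps `φ s t`, `t ≥ s`, to the strip, continuously in `t` and starting from the
identity. -/
theorem exists_lift (hd : 1 ≤ d) (hr : IsCanonicalSystem d r) (hnd : IsNondegenerate r)
    (hφ : IsEvolutionFamilyOver d r φ) {s : ℝ} (hs : 0 ≤ s) :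
    ∃ P : ℝ → ℂ → ℂ, (∀ t, s ≤ t → DifferentiableOn ℂ (P t) strip) ∧ EqOn (P s) id strip ∧
      (∀ t, s ≤ t → EqOn (stripMap r t ∘ P t) (φ s t ∘ stripMap r s) strip) ∧
      ∀ ζ ∈ strip, ContinuousOn (fun t => P t ζ) (Ici s) := by
  have hW : MapsTo (stripMap r s) strip (annulus (r s)) := fun ζ hζ =>
    (hr.stripMap_mem_iff hnd hs ζ).2 hζ
  have hWd : DifferentiableOn ℂ (stripMap r s) strip := (differentiable_stripMap r s).differentiableOn
  have hann : ∀ t, s ≤ t → ∀ ζ ∈ strip, φ s t (stripMap r s ζ) ∈ annulus (r t) :=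
    fun t ht ζ hζ => hφ.mapsTo s t hs ht (hW hζ)
  have hne : ∀ t, s ≤ t → ∀ ζ ∈ strip, φ s t (stripMap r s ζ) ≠ 0 := fun t ht ζ hζ h => by
    have := (hann t ht ζ hζ).1
    rw [h, norm_zero] at this
    exact absurd this (hr.radius_pos hnd (hs.trans ht)).le.not_gt
  have hG : ContinuousOn (fun q : ℂ × ℝ => φ s q.2 (stripMap r s q.1)) (strip ×ˢ Ici s) :=
    continuousOn_of_separately (G := fun ζ t => φ s t (stripMap r s ζ)) isOpen_strip
      (fun t ht => (hφ.holo s t hs ht).comp hWd hW) (fun ζ hζ t ht => (hann t ht ζ hζ).2.le)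
      fun ζ hζ => hφ.continuousOn hd hs (hW hζ)
  set U : Set (ℂ × ℝ) := strip ×ˢ univ with hUdef
  have hUo : IsOpen U := isOpen_strip.prod isOpen_univ
  have hUc : IsSimplyConnected U := by
    have hne : U.Nonempty := ⟨((1 / 2 : ℝ), 0), by
      refine ⟨?_, trivial⟩
      simp only [strip, mem_ofPred_eq, Complex.ofReal_re]
      norm_num⟩
    have := (convex_strip.prod (convex_univ (𝕜 := ℝ) (E := ℝ))).contractibleSpace hne
    exact (inferInstance : SimplyConnectedSpace (strip ×ˢ univ : Set (ℂ × ℝ)))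
  -- `max s` freezes the family for times before `s`, so that the logarithm can be taken on an open
  -- set.
  have hgc : ContinuousOn (fun q : ℂ × ℝ => φ s (max s q.2) (stripMap r s q.1)) U :=
    hG.comp (f := fun q : ℂ × ℝ => (q.1, max s q.2)) (by fun_prop)
      fun q hq => ⟨hq.1, le_max_left s q.2⟩
  obtain ⟨L, hLc, hL⟩ := Complex.exists_continuousOn_eqOn_exp_comp hUc hUo hgc (by
    rintro ⟨q, hq, h⟩
    exact hne _ (le_max_left _ _) _ hq.1 h)
  have hLe : ∀ ζ ∈ strip, ∀ t, s ≤ t → Complex.exp (L (ζ, t)) = φ s t (stripMap r s ζ) :=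
    fun ζ hζ t ht => by
      have := hL (show (ζ, t) ∈ U from ⟨hζ, trivial⟩)
      simpa [max_eq_right ht] using this
  have hLs : ∀ ζ ∈ strip, Complex.exp (L (ζ, s)) = stripMap r s ζ := fun ζ hζ => by
    rw [hLe ζ hζ s le_rfl, hφ.ef1 s hs (hW hζ), id]
  have hLd : ∀ t, s ≤ t → DifferentiableOn ℂ (fun ζ => L (ζ, t)) strip := fun t ht => by
    refine differentiableOn_of_exp isOpen_strip ?_ ?_
    · exact hLc.comp (f := fun ζ : ℂ => (ζ, t)) (by fun_prop) fun ζ hζ => ⟨hζ, trivial⟩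
    · exact ((hφ.holo s t hs ht).comp hWd hW).congr fun ζ hζ => hLe ζ hζ t ht
  have hl0 : ∀ t, s ≤ t → ((Real.log (r t) : ℝ) : ℂ) ≠ 0 := fun t ht => by
    exact_mod_cast (hr.log_neg hnd (hs.trans ht)).ne
  -- Replacing `L (ζ, s)` by `ζ log r(s)`, another logarithm of the same value, leaves the
  -- exponential unchanged and makes the lift start at the identity.
  refine ⟨fun t ζ => (ζ * (Real.log (r s) : ℂ) + (L (ζ, t) - L (ζ, s))) / (Real.log (r t) : ℂ),
    fun t ht => ?_, fun ζ _ => ?_, fun t ht ζ hζ => ?_, fun ζ hζ => ?_⟩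
  · exact (((differentiableOn_id.mul_const _).add ((hLd t ht).sub (hLd s le_rfl))).div_const _)
  · simp only [sub_self, add_zero, id]
    rw [mul_div_cancel_right₀ _ (hl0 s le_rfl)]
  · simp only [Function.comp_apply]
    rw [stripMap, div_mul_cancel₀ _ (hl0 t ht), Complex.exp_add, Complex.exp_sub, hLs ζ hζ,
      hLe ζ hζ t ht]
    exact mul_div_cancel₀ _ (Complex.exp_ne_zero _)
  · have hl : ContinuousOn (fun t => ((Real.log (r t) : ℝ) : ℂ)) (Ici s) :=
      Complex.continuous_ofReal.comp_continuousOn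
        ((hr.continuousOn_log hnd).mono (Ici_subset_Ici.2 hs))
    refine ContinuousOn.div (continuousOn_const.add (ContinuousOn.sub ?_ continuousOn_const)) hl
      fun t ht => hl0 t ht
    exact hLc.comp (f := fun t : ℝ => (ζ, t)) (by fun_prop) fun t _ => ⟨hζ, trivial⟩

end Lift

/-! ### Transfer between the strip and the half-plane. -/

/-- The conformal map `ζ ↦ exp (π i ζ)` of the strip onto the upper half-plane. -/
def toHalf (ζ : ℂ) : ℂ := Complex.exp (ζ * (Real.pi * Complex.I))

/-- The inverse of `toHalf`. -/
def ofHalf (w : ℂ) : ℂ := Complex.log w / (Real.pi * Complex.I)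

theorem pi_mul_I_ne_zero : (Real.pi * Complex.I : ℂ) ≠ 0 :=
  mul_ne_zero (by exact_mod_cast Real.pi_ne_zero) Complex.I_ne_zero

theorem im_toHalf (ζ : ℂ) :
    (toHalf ζ).im = Real.exp (-(Real.pi * ζ.im)) * Real.sin (Real.pi * ζ.re) := by
  rw [toHalf, Complex.exp_im]
  simp [mul_comm]

theorem toHalf_mem {ζ : ℂ} (hζ : ζ ∈ strip) : toHalf ζ ∈ upperHalf := by
  change 0 < (toHalf ζ).im
  rw [im_toHalf]
  refine mul_pos (Real.exp_pos _) (Real.sin_pos_of_pos_of_lt_pi ?_ ?_)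
  · exact mul_pos Real.pi_pos hζ.1
  · exact mul_lt_of_lt_one_right Real.pi_pos hζ.2

theorem ofHalf_mem {w : ℂ} (hw : w ∈ upperHalf) : ofHalf w ∈ strip := by
  have hw' : 0 < w.im := hw
  have hre : (ofHalf w).re = w.arg / Real.pi := by
    rw [ofHalf, Complex.div_re]
    simp [Complex.normSq_apply, Complex.log_im]
    field_simp
  have h0 : 0 ≤ w.arg := Complex.arg_nonneg_iff.2 hw'.le
  have h1 : w.arg ≠ 0 := fun h => hw'.ne' (Complex.arg_eq_zero_iff.1 h).2
  have h2 : w.arg ≠ Real.pi := fun h => hw'.ne' (Complex.arg_eq_pi_iff.1 h).2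
  change 0 < (ofHalf w).re ∧ (ofHalf w).re < 1
  rw [hre, div_lt_one Real.pi_pos]
  exact ⟨div_pos (h0.lt_of_ne' h1) Real.pi_pos, (Complex.arg_le_pi w).lt_of_ne h2⟩

theorem ofHalf_toHalf {ζ : ℂ} (hζ : ζ ∈ strip) : ofHalf (toHalf ζ) = ζ := by
  have him : (ζ * (Real.pi * Complex.I)).im = ζ.re * Real.pi := by simp
  rw [ofHalf, toHalf, Complex.log_exp, mul_div_cancel_right₀ _ pi_mul_I_ne_zero]
  · rw [him]; nlinarith [Real.pi_pos, hζ.1]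
  · rw [him]; nlinarith [Real.pi_pos, hζ.2]

theorem differentiableOn_conj_toHalf {ψ : ℂ → ℂ} (hψ : DifferentiableOn ℂ ψ strip) :
    DifferentiableOn ℂ (fun w => toHalf (ψ (ofHalf w))) upperHalf := by
  have h1 : DifferentiableOn ℂ ofHalf upperHalf := by
    refine DifferentiableOn.div_const (DifferentiableOn.clog differentiableOn_id fun w hw => ?_) _
    exact Or.inr (ne_of_gt hw)
  have h2 : Differentiable ℂ toHalf := by unfold toHalf; fun_prop
  exact h2.comp_differentiableOn (hψ.comp h1 fun w hw => ofHalf_mem hw)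

theorem mapsTo_conj_toHalf {ψ : ℂ → ℂ} (hm : MapsTo ψ strip strip) :
    MapsTo (fun w => toHalf (ψ (ofHalf w))) upperHalf upperHalf :=
  fun _ hw => toHalf_mem (hm (ofHalf_mem hw))

theorem dist_toHalf_map_le {ψ : ℂ → ℂ} (hψ : DifferentiableOn ℂ ψ strip)
    (hm : MapsTo ψ strip strip) {z w : ℂ} (hz : z ∈ strip) (hw : w ∈ strip) :
    dist (⟨toHalf (ψ z), toHalf_mem (hm hz)⟩ : UpperHalfPlane) ⟨toHalf (ψ w), toHalf_mem (hm hw)⟩ ≤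
      dist (⟨toHalf z, toHalf_mem hz⟩ : UpperHalfPlane) ⟨toHalf w, toHalf_mem hw⟩ := by
  simpa only [ofHalf_toHalf hz, ofHalf_toHalf hw] using
    dist_map_le (differentiableOn_conj_toHalf hψ) (mapsTo_conj_toHalf hm)
      ⟨toHalf z, toHalf_mem hz⟩ ⟨toHalf w, toHalf_mem hw⟩

theorem norm_toHalf_sub_le {ζ ζ' : ℂ} (h : ‖ζ' - ζ‖ ≤ 1 / 4) :
    ‖toHalf ζ' - toHalf ζ‖ ≤ ‖toHalf ζ‖ * (2 * Real.pi * ‖ζ' - ζ‖) := by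
  have e : toHalf ζ' - toHalf ζ =
      toHalf ζ * (Complex.exp ((ζ' - ζ) * (Real.pi * Complex.I)) - 1) := by
    rw [toHalf, toHalf, mul_sub, ← Complex.exp_add]; ring_nf
  have hn : ‖(ζ' - ζ) * (Real.pi * Complex.I)‖ = Real.pi * ‖ζ' - ζ‖ := by
    rw [norm_mul, norm_mul, Complex.norm_I, Complex.norm_real,
      Real.norm_of_nonneg Real.pi_pos.le]; ring
  rw [e, norm_mul, mul_assoc 2, ← hn]
  gcongr
  refine Complex.norm_exp_sub_one_le ?_
  rw [hn]
  nlinarith [Real.pi_le_four, Real.pi_pos, norm_nonneg (ζ' - ζ)]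

theorem norm_ofHalf_sub_le {c : ℝ} (hc : 0 < c) {w w' : ℂ} (hw : c ≤ w.im) (hw' : c ≤ w'.im) :
    ‖ofHalf w' - ofHalf w‖ ≤ 1 / (c * Real.pi) * ‖w' - w‖ := by
  refine Convex.norm_image_sub_le_of_norm_hasDerivWithin_le (s := {z : ℂ | c ≤ z.im})
    (f' := fun z => z⁻¹ / (Real.pi * Complex.I)) (fun z hz => ?_) (fun z hz => ?_)
    (convex_halfSpace_im_ge c) hw hw'
  · refine ((Complex.hasDerivAt_log (Or.inr ?_)).div_const _).hasDerivWithinAt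
    exact (hc.trans_le hz).ne'
  · have : c ≤ ‖z‖ := le_trans hz ((le_abs_self _).trans (Complex.abs_im_le_norm z))
    rw [norm_div, norm_inv, norm_mul, Complex.norm_I, Complex.norm_real,
      Real.norm_of_nonneg Real.pi_pos.le, mul_one, ← one_div, div_div]
    have := Real.pi_pos
    gcongr

/-- The analogue of `exists_two_point_bound` for holomorphic self-maps of the strip. -/
theorem exists_strip_two_point_bound {c M κ : ℝ} (hc : 0 < c) (hM : 0 < M) (hκ : 0 < κ) :
    ∃ C η : ℝ, 0 < C ∧ 0 < η ∧ ∀ ψ : ℂ → ℂ, DifferentiableOn ℂ ψ strip →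
      MapsTo ψ strip strip → ∀ z ∈ strip, ∀ w ∈ strip, ∀ p ∈ strip,
      c ≤ (toHalf z).im → c ≤ (toHalf w).im → c ≤ (toHalf p).im →
      ‖toHalf z‖ ≤ M → ‖toHalf w‖ ≤ M → ‖toHalf p‖ ≤ M → κ ≤ ‖toHalf w - toHalf p‖ →
      ∀ ε ≤ η, ‖ψ w - w‖ ≤ ε → ‖ψ p - p‖ ≤ ε →
      ‖ψ z - z‖ ≤ C * ε ∧ ‖toHalf (ψ z) - toHalf z‖ ≤ C * ε := by
  obtain ⟨C, η, hC, hη, H⟩ := exists_two_point_bound hc hM hκ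
  have hpi := Real.pi_pos
  set B : ℝ := C * (M * (2 * Real.pi)) with hB
  have hB0 : 0 < B := by positivity
  -- The three bounds on `ε` serve, in order, the Lipschitz estimate for `toHalf`, the half-plane
  -- lemma, and keeping `toHalf (ψ z)` at height at least `c/2`, where `ofHalf` is Lipschitz.
  refine ⟨max B (1 / (c / 2 * Real.pi) * B), min (1 / 4) (min (η / (M * (2 * Real.pi))) (c / 2 / B)),
    lt_max_of_lt_left hB0, lt_min (by norm_num) (lt_min (by positivity) (by positivity)), ?_⟩
  intro ψ hψ hm z hz w hw p hp hzc hwc hpc hzM hwM hpM hwp ε hε hψw hψp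
  have hε0 : 0 ≤ ε := (norm_nonneg _).trans hψw
  have hε1 : ε ≤ 1 / 4 := hε.trans (min_le_left _ _)
  have hε2 : M * (2 * Real.pi) * ε ≤ η := by
    have := hε.trans ((min_le_right _ _).trans (min_le_left _ _))
    rw [le_div_iff₀ (by positivity)] at this
    linarith
  have hε3 : B * ε ≤ c / 2 := by
    have := hε.trans ((min_le_right _ _).trans (min_le_right _ _))
    rw [le_div_iff₀ hB0] at this
    linarith
  have hlip : ∀ q, ‖toHalf q‖ ≤ M → ‖ψ q - q‖ ≤ ε →
      ‖toHalf (ψ q) - toHalf q‖ ≤ M * (2 * Real.pi) * ε := fun q hqM hq => by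
    refine (norm_toHalf_sub_le (hq.trans hε1)).trans ?_
    rw [← mul_assoc]
    gcongr
  have h1 := H _ (differentiableOn_conj_toHalf hψ) (mapsTo_conj_toHalf hm) (toHalf z) (toHalf w)
    (toHalf p) hzc hwc hpc hzM hwM hpM hwp _ hε2
    (by simpa only [ofHalf_toHalf hw] using hlip w hwM hψw)
    (by simpa only [ofHalf_toHalf hp] using hlip p hpM hψp)
  simp only [ofHalf_toHalf hz] at h1
  rw [← mul_assoc, ← hB] at h1
  have him : c / 2 ≤ (toHalf (ψ z)).im := by
    have := (abs_le.1 ((Complex.abs_im_le_norm _).trans (h1.trans hε3))).1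
    rw [Complex.sub_im] at this
    linarith
  have h2 := norm_ofHalf_sub_le (half_pos hc) (le_trans (by linarith) hzc) him
  rw [ofHalf_toHalf hz, ofHalf_toHalf (hm hz)] at h2
  refine ⟨h2.trans ?_, h1.trans (mul_le_mul_of_nonneg_right (le_max_left _ _) hε0)⟩
  refine le_trans (mul_le_mul_of_nonneg_left h1 (by positivity)) ?_
  rw [← mul_assoc]
  exact mul_le_mul_of_nonneg_right (le_max_right _ _) hε0

/-! ### Continuous lifts: composition, uniqueness, anchors. -/

/-- A lift of `φ` to the strip which depends continuously on the final time. -/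
structure IsContinuousLift (r : ℝ → ℝ) (φ Ψ : ℝ → ℝ → ℂ → ℂ) : Prop where
  holo : ∀ s t, 0 ≤ s → s ≤ t → DifferentiableOn ℂ (Ψ s t) strip
  init : ∀ s, 0 ≤ s → EqOn (Ψ s s) id strip
  lift : IsStripLift r φ Ψ
  cont : ∀ s, 0 ≤ s → ∀ ζ ∈ strip, ContinuousOn (fun t => Ψ s t ζ) (Ici s)

variable {d : ℝ≥0∞} {r : ℝ → ℝ} {φ Ψ : ℝ → ℝ → ℂ → ℂ}

theorem exists_isContinuousLift (hd : 1 ≤ d) (hr : IsCanonicalSystem d r)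
    (hnd : IsNondegenerate r) (hφ : IsEvolutionFamilyOver d r φ) :
    ∃ Ψ, IsContinuousLift r φ Ψ := by
  have h : ∀ s : ℝ, ∃ P : ℝ → ℂ → ℂ, 0 ≤ s → (∀ t, s ≤ t → DifferentiableOn ℂ (P t) strip) ∧
      EqOn (P s) id strip ∧
      (∀ t, s ≤ t → EqOn (stripMap r t ∘ P t) (φ s t ∘ stripMap r s) strip) ∧
      ∀ ζ ∈ strip, ContinuousOn (fun t => P t ζ) (Ici s) := fun s => by
    by_cases hs : 0 ≤ s
    · obtain ⟨P, hP⟩ := exists_lift hd hr hnd hφ hs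
      exact ⟨P, fun _ => hP⟩
    · exact ⟨fun _ => id, fun h => absurd h hs⟩
  choose Ψ hΨ using h
  exact ⟨Ψ, fun s t hs hst => (hΨ s hs).1 t hst, fun s hs => (hΨ s hs).2.1,
    fun s t hs hst => (hΨ s hs).2.2.1 t hst, fun s hs => (hΨ s hs).2.2.2⟩

namespace IsContinuousLift

theorem mapsTo (hΨ : IsContinuousLift r φ Ψ) (hr : IsCanonicalSystem d r)
    (hnd : IsNondegenerate r) (hφ : IsEvolutionFamilyOver d r φ) {s t : ℝ} (hs : 0 ≤ s)
    (hst : s ≤ t) : MapsTo (Ψ s t) strip strip := fun ζ hζ => by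
  rw [← hr.stripMap_mem_iff hnd (hs.trans hst)]
  have := hΨ.lift s t hs hst hζ
  simp only [Function.comp_apply] at this
  rw [this]
  exact hφ.mapsTo s t hs hst ((hr.stripMap_mem_iff hnd hs ζ).2 hζ)

/-- As functions of `t ≥ u`, both sides are continuous lifts of the same path and agree at `t = u`.
-/
theorem comp (hΨ : IsContinuousLift r φ Ψ) (hr : IsCanonicalSystem d r)
    (hnd : IsNondegenerate r) (hφ : IsEvolutionFamilyOver d r φ) {s u t : ℝ} (hs : 0 ≤ s)
    (hsu : s ≤ u) (hut : u ≤ t) : EqOn (Ψ s t) (Ψ u t ∘ Ψ s u) strip := fun ζ hζ => by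
  have hu := hs.trans hsu
  have hm := hΨ.mapsTo hr hnd hφ hs hsu hζ
  refine hr.eqOn_of_stripMap_eq hnd hu (p := fun t => Ψ s t ζ) (q := fun t => Ψ u t (Ψ s u ζ))
    ((hΨ.cont s hs ζ hζ).mono (Ici_subset_Ici.2 hsu)) (hΨ.cont u hu _ hm) (fun τ hτ => ?_)
    (hΨ.init u hu hm).symm hut
  have h1 := hΨ.lift s τ hs (hsu.trans hτ) hζ
  have h2 := hΨ.lift u τ hu hτ hm
  have h3 := hΨ.lift s u hs hsu hζ
  have h4 := hφ.ef2 s u τ hs hsu hτ ((hr.stripMap_mem_iff hnd hs ζ).2 hζ)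
  simp only [Function.comp_apply] at h1 h2 h3 h4
  rw [h1, h2, h3, h4]

theorem eqOn_of_isEvolutionFamilyIn (hd : 1 ≤ d) (hΨ : IsContinuousLift r φ Ψ)
    (hr : IsCanonicalSystem d r) (hnd : IsNondegenerate r) {Ψ' : ℝ → ℝ → ℂ → ℂ}
    (hΨ' : IsEvolutionFamilyIn d strip Ψ') (hl : IsStripLift r φ Ψ') {s t : ℝ} (hs : 0 ≤ s)
    (hst : s ≤ t) : EqOn (Ψ' s t) (Ψ s t) strip := fun ζ hζ =>
  hr.eqOn_of_stripMap_eq hnd hs (p := fun t => Ψ' s t ζ) (q := fun t => Ψ s t ζ)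
    (hΨ'.continuousOn hd hs hζ) (hΨ.cont s hs ζ hζ)
    (fun τ hτ => (hl s τ hs hτ hζ).trans (hΨ.lift s τ hs hτ hζ).symm)
    ((hΨ'.ef1 s hs hζ).trans (hΨ.init s hs hζ).symm) hst

/-- The points `x log r(0) / log r(u)` lie over a fixed point of the annuli, and `Ψ u t` displaces
them by at most `∫ k` with `k` in `L^d`. -/
theorem exists_anchor_bound (hd : 1 ≤ d) (hΨ : IsContinuousLift r φ Ψ)
    (hr : IsCanonicalSystem d r) (hnd : IsNondegenerate r) (hφ : IsEvolutionFamilyOver d r φ)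
    {T : ℝ} (hT : 0 < T) {x : ℝ} (hx0 : 0 < x) (hx1 : x < 1) :
    ∃ k : ℝ → ℝ, (∀ ξ ∈ Icc 0 T, 0 ≤ k ξ) ∧ MemLp k d (volume.restrict (Icc 0 T)) ∧
      ∀ u t, 0 ≤ u → u ≤ t → t ≤ T →
        ‖Ψ u t (x * (Real.log (r 0) / Real.log (r u)) : ℝ) -
          (x * (Real.log (r 0) / Real.log (r u)) : ℝ)‖ ≤ ∫ ξ in u..t, k ξ := by
  have hl0 := hr.log_neg hnd le_rfl
  set z : ℂ := stripMap r 0 x with hz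
  have hxs : ((x : ℝ) : ℂ) ∈ strip := ⟨by simpa using hx0, by simpa using hx1⟩
  have hzm : z ∈ annulus (r 0) := (hr.stripMap_mem_iff hnd le_rfl _).2 hxs
  -- One `k₁` serves every starting time `u`, since each anchor lies over this same `z`.
  obtain ⟨k₁, hk0, hkm, hkb⟩ := hφ.ef3 0 T le_rfl hT.le z hzm
  obtain ⟨hac, hom⟩ := hr.ac 0 T hT.le Icc_subset_Ici_self
  have hkint := hkm.integrableOn_Icc hd
  have hii : ∀ {f : ℝ → ℝ}, IntegrableOn f (Icc 0 T) → ∀ u t, 0 ≤ u → u ≤ t → t ≤ T →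
      IntervalIntegrable f volume u t := fun {f} hf u t h1 h2 h3 =>
    (hf.mono_set (by rw [uIcc_of_le h2]; exact Icc_subset_Icc h1 h3)).intervalIntegrable
  have hρ := hr.radius_pos hnd hT.le
  set A : ℝ := 2 / r T * (-(Real.log (r 0))⁻¹) with hA
  set B : ℝ := x * (-Real.log (r 0)) / Real.pi with hB
  have hA0 : 0 ≤ A := mul_nonneg (by positivity) (neg_nonneg.2 (inv_nonpos.2 hl0.le))
  have hB0 : 0 ≤ B := div_nonneg (mul_nonneg hx0.le (neg_nonneg.2 hl0.le)) Real.pi_pos.le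
  refine ⟨fun ξ => A * k₁ ξ + B * |deriv (fun t => omega (r t)) ξ|,
    fun ξ hξ => add_nonneg (mul_nonneg hA0 (hk0 ξ hξ)) (by positivity),
    (hkm.const_mul A).add (hom.norm.const_mul B), fun u t hu hut htT => ?_⟩
  have ht := hu.trans hut
  have hlu := hr.log_neg hnd hu
  have hlt := hr.log_neg hnd ht
  set ζ : ℂ := ((x * (Real.log (r 0) / Real.log (r u)) : ℝ) : ℂ) with hζ
  have hζu : ζ * (Real.log (r u) : ℂ) = (x * Real.log (r 0) : ℝ) := by
    rw [hζ, ← Complex.ofReal_mul]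
    congr 1
    field_simp [hlu.ne]
  have hWζ : stripMap r u ζ = z := by
    rw [hz, stripMap, hζu, stripMap]
    push_cast
    rfl
  have hζs : ζ ∈ strip := by
    rw [← hr.stripMap_mem_iff hnd hu, hWζ]
    exact hr.annulus_subset hnd le_rfl hu hzm
  set g : ℝ → ℂ := fun τ => Ψ u τ ζ * (Real.log (r τ) : ℂ) with hg
  have hgu : g u = (x * Real.log (r 0) : ℝ) := by
    rw [← hζu, hg]
    simp only [hΨ.init u hu hζs, id]
  have hge : ∀ τ, u ≤ τ → Complex.exp (g τ) = φ u τ z := fun τ hτ => by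
    rw [← hWζ]
    exact hΨ.lift u τ hu hτ hζs
  have hgc : ContinuousOn g (Icc u T) := by
    refine (((hΨ.cont u hu ζ hζs).mono Icc_subset_Ici_self).mul ?_)
    exact Complex.continuous_ofReal.comp_continuousOn
      ((hr.continuousOn_log hnd).mono fun τ hτ => hu.trans hτ.1)
  have hprim : ∀ u t, 0 ≤ u → u ≤ t → t ≤ T →
      (∫ ξ in (0 : ℝ)..t, k₁ ξ) - ∫ ξ in (0 : ℝ)..u, k₁ ξ = ∫ ξ in u..t, k₁ ξ :=
    fun u t h1 h2 h3 => intervalIntegral.integral_interval_sub_left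
      (hii hkint 0 t le_rfl (h1.trans h2) h3) (hii hkint 0 u le_rfl h1 (h2.trans h3))
  have hgb := norm_sub_le_of_exp (K := fun τ => ∫ ξ in (0 : ℝ)..τ, k₁ ξ) hρ hgc
    (fun τ hτ => by
      rw [hge τ hτ.1]
      exact (hr.radius_anti hnd (hu.trans hτ.1) hτ.2).trans
        (hφ.mapsTo u τ hu hτ.1 (hr.annulus_subset hnd le_rfl hu hzm)).1.le)
    (fun v τ h1 h2 h3 => by
      rw [hge v h1, hge τ (h1.trans h2), norm_sub_rev, hprim v τ (hu.trans h1) h2 h3]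
      exact hkb u v τ hu h1 h2 h3) u t le_rfl hut htT
  simp only [hprim u t hu hut htT] at hgb
  have hlt' : ((Real.log (r t) : ℝ) : ℂ) ≠ 0 := by exact_mod_cast hlt.ne
  have hlu' : ((Real.log (r u) : ℝ) : ℂ) ≠ 0 := by exact_mod_cast hlu.ne
  -- A discrete product rule for `g · (log r)⁻¹`: `k₁` controls the increment of `g`, and the
  -- derivative of `ω` controls that of `(log r)⁻¹ = -ω/π`.
  have hdec : Ψ u t ζ - ζ = (g t - g u) * ((Real.log (r t))⁻¹ : ℝ) +
      g u * (((Real.log (r t))⁻¹ - (Real.log (r u))⁻¹ : ℝ) : ℂ) := by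
    rw [hgu, ← hζu, hg]
    push_cast
    field_simp
    ring
  have hinv : ‖(((Real.log (r t))⁻¹ : ℝ) : ℂ)‖ ≤ -(Real.log (r 0))⁻¹ := by
    rw [Complex.norm_real, Real.norm_of_nonpos (inv_nonpos.2 hlt.le)]
    exact neg_le_neg (hr.inv_log_mono hnd le_rfl ht)
  have hdi : IntegrableOn (fun ξ => |deriv (fun t => omega (r t)) ξ|) (Icc 0 T) :=
    (hom.integrableOn_Icc hd).abs
  have hω : ‖(((Real.log (r t))⁻¹ - (Real.log (r u))⁻¹ : ℝ) : ℂ)‖ ≤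
      1 / Real.pi * ∫ ξ in u..t, |deriv (fun t => omega (r t)) ξ| := by
    have h1 := (hac.mono (c := u) (d := t) (by
      rw [uIcc_of_le hut, uIcc_of_le hT.le]
      exact Icc_subset_Icc hu htT)).integral_deriv_eq_sub
    have h2 := intervalIntegral.abs_integral_le_integral_abs (μ := volume)
      (f := deriv (fun t => omega (r t))) hut
    rw [h1] at h2
    have h3 : (Real.log (r t))⁻¹ - (Real.log (r u))⁻¹ =
        -(1 / Real.pi * (omega (r t) - omega (r u))) := by
      rw [inv_log_eq hnd ht, inv_log_eq hnd hu]; ring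
    rw [Complex.norm_real, h3, norm_neg, norm_mul, Real.norm_of_nonneg (by positivity)]
    exact mul_le_mul_of_nonneg_left h2 (by positivity)
  have hgun : ‖g u‖ = x * (-Real.log (r 0)) := by
    rw [hgu, Complex.norm_real, Real.norm_of_nonpos (mul_nonpos_of_nonneg_of_nonpos hx0.le hl0.le)]
    ring
  rw [intervalIntegral.integral_add ((hii hkint u t hu hut htT).const_mul A)
    ((hii hdi u t hu hut htT).const_mul B), intervalIntegral.integral_const_mul,
    intervalIntegral.integral_const_mul, hdec]
  refine (norm_add_le _ _).trans (add_le_add ?_ ?_)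
  · rw [norm_mul]
    refine (mul_le_mul hgb hinv (norm_nonneg _) ((norm_nonneg _).trans hgb)).trans_eq ?_
    rw [hA]; ring
  · rw [norm_mul, hgun]
    refine (mul_le_mul_of_nonneg_left hω (mul_nonneg hx0.le (neg_nonneg.2 hl0.le))).trans_eq ?_
    rw [hB]; ring

end IsContinuousLift

/-! ### Displacement bounds, compactness of orbits, conclusion. -/

theorem norm_toHalf_ofReal (x : ℝ) : ‖toHalf x‖ = 1 := by
  rw [toHalf, Complex.norm_exp]
  simp

theorem im_toHalf_ofReal (x : ℝ) : (toHalf x).im = Real.sin (Real.pi * x) := by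
  rw [im_toHalf]; simp

/-- Doubling `x` squares `toHalf x`, which has modulus 1. This separates the two anchors used below,
one being twice the other. -/
theorem im_toHalf_le_norm_sub (x : ℝ) : (toHalf x).im ≤ ‖toHalf (2 * x : ℝ) - toHalf x‖ := by
  have e : toHalf (2 * x : ℝ) - toHalf x = toHalf x * (toHalf x - 1) := by
    rw [toHalf, toHalf, mul_sub, ← Complex.exp_add]
    push_cast
    ring_nf
  rw [e, norm_mul, norm_toHalf_ofReal, one_mul]
  refine le_trans (le_of_eq ?_) ((le_abs_self _).trans (Complex.abs_im_le_norm _))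
  simp

namespace IsContinuousLift

/-- On compact subsets of the strip, the displacement of `Ψ u t` for close times `u ≤ t` is
controlled by the integral over `[u, t]` of one function in `L^d`. -/
theorem exists_displacement_bound (hd : 1 ≤ d) (hΨ : IsContinuousLift r φ Ψ)
    (hr : IsCanonicalSystem d r) (hnd : IsNondegenerate r) (hφ : IsEvolutionFamilyOver d r φ)
    {T : ℝ} (hT : 0 < T) :
    ∃ k : ℝ → ℝ, (∀ ξ ∈ Icc 0 T, 0 ≤ k ξ) ∧ MemLp k d (volume.restrict (Icc 0 T)) ∧
      ∀ c M : ℝ, 0 < c → 0 < M → ∃ C δ : ℝ, 0 < C ∧ 0 < δ ∧ ∀ z ∈ strip, c ≤ (toHalf z).im →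
        ‖toHalf z‖ ≤ M → ∀ u t, 0 ≤ u → u ≤ t → t ≤ T → t - u ≤ δ →
        ‖Ψ u t z - z‖ ≤ C * ∫ ξ in u..t, k ξ ∧
        ‖toHalf (Ψ u t z) - toHalf z‖ ≤ C * ∫ ξ in u..t, k ξ := by
  obtain ⟨k₁, hk10, hk1m, hk1⟩ := hΨ.exists_anchor_bound hd hr hnd hφ hT
    (x := 1 / 4) (by norm_num) (by norm_num)
  obtain ⟨k₂, hk20, hk2m, hk2⟩ := hΨ.exists_anchor_bound hd hr hnd hφ hT
    (x := 1 / 2) (by norm_num) (by norm_num)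
  refine ⟨fun ξ => k₁ ξ + k₂ ξ, fun ξ hξ => add_nonneg (hk10 ξ hξ) (hk20 ξ hξ), hk1m.add hk2m,
    fun c M hc hM => ?_⟩
  have hi1 := hk1m.integrableOn_Icc hd
  have hi2 := hk2m.integrableOn_Icc hd
  have hii : ∀ {f : ℝ → ℝ}, IntegrableOn f (Icc 0 T) → ∀ u t, 0 ≤ u → u ≤ t → t ≤ T →
      IntervalIntegrable f volume u t := fun {f} hf u t h1 h2 h3 =>
    (hf.mono_set (by rw [uIcc_of_le h2]; exact Icc_subset_Icc h1 h3)).intervalIntegrable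
  have hlT := hr.log_neg hnd hT.le
  have hl0 := hr.log_neg hnd le_rfl
  set ℓ : ℝ → ℝ := fun u => Real.log (r 0) / Real.log (r u) with hℓ
  have hℓ0 : 0 < ℓ T := div_pos_of_neg_of_neg hl0 hlT
  have hℓT : ∀ u, 0 ≤ u → u ≤ T → ℓ T ≤ ℓ u := fun u h1 h2 => by
    have := hr.inv_log_mono hnd h1 h2
    simp only [hℓ, div_eq_mul_inv]
    exact mul_le_mul_of_nonpos_left this hl0.le
  have hℓ1 : ∀ u, 0 ≤ u → ℓ u ≤ 1 := fun u h1 =>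
    (div_le_one_of_neg (hr.log_neg hnd h1)).2 (hr.log_anti hnd le_rfl h1)
  have hpi := Real.pi_pos
  -- The anchors stay in `[ℓ T / 4, 1/2]`, where `sin (π x)` increases, so `c₀` bounds their heights
  -- from below.
  set c₀ : ℝ := Real.sin (Real.pi * (1 / 4 * ℓ T)) with hc₀
  have hc₀0 : 0 < c₀ := by
    have := hℓ1 T hT.le
    refine Real.sin_pos_of_pos_of_lt_pi (by positivity) ?_
    nlinarith
  have hanchor : ∀ x : ℝ, 1 / 4 ≤ x → x ≤ 1 / 2 → ∀ u, 0 ≤ u → u ≤ T →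
      ((x * ℓ u : ℝ) : ℂ) ∈ strip ∧ c₀ ≤ (toHalf (x * ℓ u : ℝ)).im := by
    intro x hx hx' u h1 h2
    have e1 := hℓT u h1 h2
    have e2 := hℓ1 u h1
    have e3 : 1 / 4 * ℓ T ≤ x * ℓ u := mul_le_mul hx e1 hℓ0.le (by linarith)
    have e4 : x * ℓ u ≤ 1 / 2 := by nlinarith
    refine ⟨⟨?_, ?_⟩, ?_⟩
    · rw [Complex.ofReal_re]; linarith
    · rw [Complex.ofReal_re]; linarith
    · rw [im_toHalf_ofReal, hc₀]
      refine Real.sin_le_sin_of_le_of_le_pi_div_two ?_ ?_ ?_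
      · have : 0 < Real.pi * (1 / 4 * ℓ T) := by positivity
        linarith
      · nlinarith
      · gcongr
  obtain ⟨C, η, hC, hη, H⟩ := exists_strip_two_point_bound (c := min c c₀) (M := max M 1)
    (lt_min hc hc₀0) (lt_max_of_lt_left hM) hc₀0
  have hsum : IntegrableOn (fun ξ => k₁ ξ + k₂ ξ) (Icc 0 T) := hi1.add hi2
  have hprim : ContinuousOn (fun t => ∫ ξ in (0 : ℝ)..t, (k₁ ξ + k₂ ξ)) (Icc 0 T) := by
    have := intervalIntegral.continuousOn_primitive_interval (μ := volume)
      (f := fun ξ => k₁ ξ + k₂ ξ) (a := 0) (b := T) (by rwa [uIcc_of_le hT.le])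
    rwa [uIcc_of_le hT.le] at this
  obtain ⟨δ, hδ, hδb⟩ := exists_delta_of_continuousOn hprim hη
  refine ⟨C, δ, hC, hδ, fun z hz hzc hzM u t hu hut ht hδt => ?_⟩
  have hb := hδb u t hu hut ht hδt
  rw [intervalIntegral.integral_interval_sub_left (hii hsum 0 t le_rfl (hu.trans hut) ht)
    (hii hsum 0 u le_rfl hu (hut.trans ht))] at hb
  have hadd := intervalIntegral.integral_add (hii hi1 u t hu hut ht) (hii hi2 u t hu hut ht)
  have hn1 : 0 ≤ ∫ ξ in u..t, k₁ ξ := intervalIntegral.integral_nonneg hut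
    fun ξ hξ => hk10 ξ ⟨hu.trans hξ.1, hξ.2.trans ht⟩
  have hn2 : 0 ≤ ∫ ξ in u..t, k₂ ξ := intervalIntegral.integral_nonneg hut
    fun ξ hξ => hk20 ξ ⟨hu.trans hξ.1, hξ.2.trans ht⟩
  obtain ⟨hp, hpc⟩ := hanchor (1 / 4) le_rfl (by norm_num) u hu (hut.trans ht)
  obtain ⟨hw, hwc⟩ := hanchor (1 / 2) (by norm_num) le_rfl u hu (hut.trans ht)
  refine H (Ψ u t) (hΨ.holo u t hu hut) (hΨ.mapsTo hr hnd hφ hu hut) z hz _ hw _ hp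
    ((min_le_left _ _).trans hzc) ((min_le_right _ _).trans hwc) ((min_le_right _ _).trans hpc)
    (hzM.trans (le_max_left _ _)) ?_ ?_ ?_ _ ((le_abs_self _).trans hb) ?_ ?_
  · rw [norm_toHalf_ofReal]; exact le_max_right _ _
  · rw [norm_toHalf_ofReal]; exact le_max_right _ _
  · have := im_toHalf_le_norm_sub (1 / 4 * ℓ u)
    rw [show 2 * (1 / 4 * ℓ u) = 1 / 2 * ℓ u by ring] at this
    exact hpc.trans this
  · have := hk2 u t hu hut ht
    rw [hadd]
    exact this.trans (by linarith)
  · have := hk1 u t hu hut ht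
    rw [hadd]
    exact this.trans (by linarith)

/-- Orbits of a point over a compact time interval stay in a compact subset of the strip. -/
theorem exists_orbit_bound (hd : 1 ≤ d) (hΨ : IsContinuousLift r φ Ψ)
    (hr : IsCanonicalSystem d r) (hnd : IsNondegenerate r) (hφ : IsEvolutionFamilyOver d r φ)
    {T : ℝ} (hT : 0 < T) {z : ℂ} (hz : z ∈ strip) :
    ∃ c M : ℝ, 0 < c ∧ 0 < M ∧ ∀ s t, 0 ≤ s → s ≤ t → t ≤ T →
      c ≤ (toHalf (Ψ s t z)).im ∧ ‖toHalf (Ψ s t z)‖ ≤ M := by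
  obtain ⟨k, hk0, hkm, H⟩ := hΨ.exists_displacement_bound hd hr hnd hφ hT
  have hy : 0 < (toHalf z).im := toHalf_mem hz
  -- Only displacements of the single point `z` are needed here, so no prior control of its orbit is
  -- assumed.
  obtain ⟨C, δ₁, hC, hδ₁, hb⟩ := H (toHalf z).im ‖toHalf z‖ hy
    (hy.trans_le ((le_abs_self _).trans (Complex.abs_im_le_norm _)))
  have hki := hkm.integrableOn_Icc hd
  have hii : ∀ u t, 0 ≤ u → u ≤ t → t ≤ T → IntervalIntegrable k volume u t := fun u t h1 h2 h3 =>
    (hki.mono_set (by rw [uIcc_of_le h2]; exact Icc_subset_Icc h1 h3)).intervalIntegrable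
  have hprim : ContinuousOn (fun t => ∫ ξ in (0 : ℝ)..t, k ξ) (Icc 0 T) := by
    have := intervalIntegral.continuousOn_primitive_interval (μ := volume)
      (f := k) (a := 0) (b := T) (by rwa [uIcc_of_le hT.le])
    rwa [uIcc_of_le hT.le] at this
  obtain ⟨δ₂, hδ₂, hδb⟩ := exists_delta_of_continuousOn hprim
    (ε := (toHalf z).im / 2 / C) (by positivity)
  set δ := min δ₁ δ₂ with hδ
  have hδ0 : 0 < δ := lt_min hδ₁ hδ₂
  set Z : UpperHalfPlane := ⟨toHalf z, toHalf_mem hz⟩ with hZ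
  have hmem : ∀ {s t}, 0 ≤ s → s ≤ t → Ψ s t z ∈ strip := fun hs hst =>
    hΨ.mapsTo hr hnd hφ hs hst hz
  have hshort : ∀ s t (hs : 0 ≤ s) (hst : s ≤ t), t ≤ T → t - s ≤ δ →
      dist (⟨toHalf (Ψ s t z), toHalf_mem (hmem hs hst)⟩ : UpperHalfPlane) Z ≤ 1 := by
    intro s t hs hst ht hd'
    have h1 := (hb z hz le_rfl le_rfl s t hs hst ht (hd'.trans (min_le_left _ _))).2
    have h2 := hδb s t hs hst ht (hd'.trans (min_le_right _ _))
    rw [intervalIntegral.integral_interval_sub_left (hii 0 t le_rfl (hs.trans hst) ht)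
      (hii 0 s le_rfl hs (hst.trans ht))] at h2
    have h3 : ‖toHalf (Ψ s t z) - toHalf z‖ ≤ (toHalf z).im / 2 := by
      refine h1.trans ((mul_le_mul_of_nonneg_left ((le_abs_self _).trans h2) hC.le).trans_eq ?_)
      field_simp
    have h4 : (toHalf z).im / 2 ≤ (toHalf (Ψ s t z)).im := by
      have := (abs_le.1 ((Complex.abs_im_le_norm _).trans h3)).1
      rw [Complex.sub_im] at this
      linarith
    refine (UpperHalfPlane.dist_le_dist_coe_div_sqrt _ _).trans ?_
    have h5 : (toHalf z).im / 2 ≤ √((toHalf (Ψ s t z)).im * (toHalf z).im) := by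
      refine Real.le_sqrt_of_sq_le ?_
      nlinarith
    refine (div_le_one (lt_of_lt_of_le (by positivity) h5)).2 (le_trans ?_ h5)
    rwa [Complex.dist_eq]
  -- Splitting off the last piece of length `δ`, contraction bounds the distance to `z` by that of
  -- the earlier orbit point plus the short-time displacement of `z`: each piece adds at most 1.
  have hchain : ∀ n : ℕ, ∀ s t (hs : 0 ≤ s) (hst : s ≤ t), t ≤ T → t - s ≤ n * δ →
      dist (⟨toHalf (Ψ s t z), toHalf_mem (hmem hs hst)⟩ : UpperHalfPlane) Z ≤ n + 1 := by
    intro n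
    induction n with
    | zero =>
      intro s t hs hst ht hn
      simp only [Nat.cast_zero, zero_mul] at hn
      simpa using hshort s t hs hst ht (hn.trans hδ0.le)
    | succ n ih =>
      intro s t hs hst ht hn
      by_cases hd' : t - s ≤ δ
      · refine (hshort s t hs hst ht hd').trans ?_
        push_cast
        have : (0 : ℝ) ≤ n := n.cast_nonneg
        linarith
      · push Not at hd'
        push_cast at hn ⊢
        have hτ : s ≤ t - δ := by linarith
        have hτ0 : 0 ≤ t - δ := hs.trans hτ
        have hτt : t - δ ≤ t := by linarith
        have h1 := ih s (t - δ) hs hτ (by linarith) (by linarith)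
        have h2 := hshort (t - δ) t hτ0 hτt ht (by linarith)
        have h3 := dist_toHalf_map_le (hΨ.holo _ _ hτ0 hτt) (hΨ.mapsTo hr hnd hφ hτ0 hτt)
          (hmem hs hτ) hz
        have h4 : Ψ s t z = Ψ (t - δ) t (Ψ s (t - δ) z) := hΨ.comp hr hnd hφ hs hτ hτt hz
        simp only [h4]
        refine (dist_triangle _ _ _).trans (add_le_add (h3.trans h1) h2)
  obtain ⟨N, hN⟩ := exists_nat_ge (T / δ)
  rw [div_le_iff₀ hδ0] at hN
  refine ⟨(toHalf z).im / Real.exp (N + 1),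
    ‖toHalf z‖ + (toHalf z).im * Real.exp (N + 1), by positivity, by positivity,
    fun s t hs hst ht => ?_⟩
  have h1 := hchain N s t hs hst ht (by linarith)
  set Y : UpperHalfPlane := ⟨toHalf (Ψ s t z), toHalf_mem (hmem hs hst)⟩ with hY
  constructor
  · refine le_trans ?_ (UpperHalfPlane.im_div_exp_dist_le Z Y)
    rw [dist_comm]
    change _ ≤ (toHalf z).im / _
    gcongr
  · have h2 := UpperHalfPlane.dist_coe_le Y Z
    change dist (toHalf (Ψ s t z)) (toHalf z) ≤ (toHalf z).im * _ at h2
    rw [Complex.dist_eq] at h2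
    have h3 : (toHalf z).im * (Real.exp (dist Y Z) - 1) ≤ (toHalf z).im * Real.exp (N + 1) := by
      have := Real.exp_le_exp.2 h1
      gcongr
      linarith
    have h4 := norm_add_le (toHalf z) (toHalf (Ψ s t z) - toHalf z)
    rw [add_sub_cancel] at h4
    linarith

theorem isEvolutionFamilyIn (hd : 1 ≤ d) (hΨ : IsContinuousLift r φ Ψ)
    (hr : IsCanonicalSystem d r) (hnd : IsNondegenerate r) (hφ : IsEvolutionFamilyOver d r φ) :
    IsEvolutionFamilyIn d strip Ψ where
  holo := hΨ.holo
  mapsTo s t hs hst := hΨ.mapsTo hr hnd hφ hs hst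
  ef1 := hΨ.init
  ef2 s u t hs hsu hut := hΨ.comp hr hnd hφ hs hsu hut
  ef3 T hT z hz := by
    obtain ⟨k, hk0, hkm, H⟩ := hΨ.exists_displacement_bound hd hr hnd hφ hT
    obtain ⟨c, M, hc, hM, hcM⟩ := hΨ.exists_orbit_bound hd hr hnd hφ hT hz
    obtain ⟨C, δ, hC, hδ, hb⟩ := H c M hc hM
    have hki := hkm.integrableOn_Icc hd
    have hprim : ∀ u t, 0 ≤ u → u ≤ t → t ≤ T →
        (∫ ξ in (0 : ℝ)..t, k ξ) - ∫ ξ in (0 : ℝ)..u, k ξ = ∫ ξ in u..t, k ξ := by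
      have hii : ∀ t, 0 ≤ t → t ≤ T → IntervalIntegrable k volume 0 t := fun t h1 h2 =>
        (hki.mono_set (by rw [uIcc_of_le h1]; exact Icc_subset_Icc le_rfl h2)).intervalIntegrable
      intro u t h1 h2 h3
      exact intervalIntegral.integral_interval_sub_left (hii t (h1.trans h2) h3)
        (hii u h1 (h2.trans h3))
    refine ⟨fun ξ => C * k ξ, fun ξ hξ => mul_nonneg hC.le (hk0 ξ hξ), hkm.const_mul C,
      fun s u t hs hsu hut ht => ?_⟩
    -- The increment of the orbit from `v` to `τ` is the displacement by `Ψ v τ` of the point `Ψ s v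
    -- z`, which lies in the compact set given by `c` and `M`.
    have := norm_sub_le_of_local (g := fun t => Ψ s t z)
      (K := fun t => C * ∫ ξ in (0 : ℝ)..t, k ξ) (a := s) (b := T) hδ
      (fun v τ h1 h2 h3 h4 => by
        have hv := hs.trans h1
        rw [← mul_sub, hprim v τ hv h2 h3]
        have h5 := hcM s v hs h1 (h2.trans h3)
        have h6 : Ψ s τ z = Ψ v τ (Ψ s v z) := hΨ.comp hr hnd hφ hs h1 h2 hz
        simp only [h6]
        exact (hb _ (hΨ.mapsTo hr hnd hφ hs h1 hz) h5.1 h5.2 v τ hv h2 h3 h4).1) u t hsu hut ht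
    rw [← mul_sub, hprim u t (hs.trans hsu) hut ht] at this
    rwa [intervalIntegral.integral_const_mul]

end IsContinuousLift

end LoewnerAnnuli

end

theorem theorem4p6 (d : ℝ≥0∞) (hd : 1 ≤ d) (r : ℝ → ℝ)
    (hr : LoewnerAnnuli.IsCanonicalSystem d r) (hnd : LoewnerAnnuli.IsNondegenerate r)
    (φ : ℝ → ℝ → ℂ → ℂ) (hφ : LoewnerAnnuli.IsEvolutionFamilyOver d r φ) :
    ∃ Ψ : ℝ → ℝ → ℂ → ℂ,
      (LoewnerAnnuli.IsEvolutionFamilyIn d LoewnerAnnuli.strip Ψ ∧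
        LoewnerAnnuli.IsStripLift r φ Ψ) ∧
      ∀ Ψ' : ℝ → ℝ → ℂ → ℂ,
        LoewnerAnnuli.IsEvolutionFamilyIn d LoewnerAnnuli.strip Ψ' →
        LoewnerAnnuli.IsStripLift r φ Ψ' →
        ∀ s t, 0 ≤ s → s ≤ t → EqOn (Ψ' s t) (Ψ s t) LoewnerAnnuli.strip := by
  obtain ⟨Ψ, hΨ⟩ := LoewnerAnnuli.exists_isContinuousLift hd hr hnd hφ
  exact ⟨Ψ, ⟨hΨ.isEvolutionFamilyIn hd hr hnd hφ, hΨ.lift⟩, fun Ψ' h1 h2 s t hs hst =>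
    hΨ.eqOn_of_isEvolutionFamilyIn hd hr hnd h1 h2 hs hst⟩
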